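/- **Setting.** Let $d\ge 1$, $m\ge 0$, $n=2^k$ with $k\ge0$, $K=L_{d,n}=\{1,\dots,n\}^d$ and $N=n^d$. A *rectangle* is a set $\prod_{i=1}^d[a_i,b_i]\cap K$ with $1\le a_i\le b_i\le n$; it is *dyadic* if each of its sides is a dyadic interval $((a-1)2^s,a2^s]\subset[1,n]$ with integers $s\ge0$, $a\ge1$. Let $\mathcal S$ be the set of all dyadic rectangles. We observe $y=\theta^*+\sigma\epsilon\in\mathbb R^K$, where $\theta^*\in\mathbb R^K$, $\sigma>0$, and the $\epsilon_s$ are independent, mean zero, with $\max(\mathbb P[\epsilon_s\ge x],\mathbb P[\epsilon_s\le -x])\le 2e^{-x^2/2}$ for all $x\ge 0$. The coordinates of $y$ are revealed in a random order $\rho(1),\dots,\rho(N)$ (a random enumeration of $K$), which is *non-anticipating*: for every $t$ and $s$, conditionally on $(\rho(1),\dots,\rho(t),y_{\rho(1)},\dots,y_{\rho(t-1)})$, the variable $\epsilon_{\rho(t)}$ has the law of $\epsilon_s$ on the event $\{\rho(t)=s\}$. **The OLRADRE predictor** $\hat\theta^{OL}$ of degree $m$ with truncation parameter $\lambda>0$.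 For $u\in K$ let $x_u=\big(\prod_i(u_i/n)^{m_i}\big)_{|\mathbf m|\le m}$, where $\mathbf m\in\mathbb Z_{\ge0}^d$ and $|\mathbf m|=\sum_i m_i$. At round $t$, put $s=\rho(t)$. Each $S\in\mathcal S$ with $s\in S$ forms the Vovk–Azoury–Warmuth prediction $$\hat y^{(S)}_s=x_s\cdot\Big(I+\sum_{u\in U\cup\{s\}}x_ux_u^T\Big)^{-1}\sum_{u\in U}y_ux_u,\qquad U=S\cap\{\rho(1),\dots,\rho(t-1)\}.$$ Let $A_t$ be the set of $S\in\mathcal S$ with $\rho(t)\in S$ and, if $t>1$, also $\rho(t')\in S$ for some $t'<t$. With $T_\lambda(x)=\min\{\max\{x,-\lambda\},\lambda\}$ and weights $w_{S,1}=1/|\mathcal S|$, the predictor is $$\hat\theta^{OL}_{\rho(t)}=\sum_{S\in A_t}\frac{w_{S,t}}{\sum_{S'\in A_t}w_{S',t}}\,T_\lambda\big(\hat y^{(S)}_{\rho(t)}\big).$$ The weights are then updated by $w_{S,t+1}=w_{S,t}$ for $S\notin A_t$ and, for $S\in A_t$, $$w_{S,t+1}=\frac{w_{S,t}e^{-\ell_{S,t}/(8\lambda^2)}}{\sum_{S'\in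 A_t}w_{S',t}e^{-\ell_{S',t}/(8\lambda^2)}}\sum_{S'\in A_t}w_{S',t},\qquad \ell_{S,t}=\big(T_\lambda(y_{\rho(t)})-T_\lambda(\hat y^{(S)}_{\rho(t)})\big)^2 .$$ **Theorem 5.1.** There exist an absolute constant $C>0$ and numbers $C_{m,d}>1$ depending only on $m$ and $d$ such that, in the setting above, if $\lambda\ge C\big(\sigma\sqrt{\log N}\vee\|\theta^*\|_\infty\big)$, then for every non-anticipating ordering $\rho$ and simultaneously for every nonempty $\mathsf T\subset K$, $$\mathbb E\,\frac1{|\mathsf T|}\|\hat\theta^{OL}_{\mathsf T}-\theta^*_{\mathsf T}\|^2\le\inf_{P,\theta}\Big(\frac1{|\mathsf T|}\|\theta^*_{\mathsf T}-\theta\|^2+C_{m,d}\,\big(\lambda+s_{m,\infty}(\theta)\big)^2\,\frac{|P|}{|\mathsf T|}\,(\log en)^d\,\log(2^dN)\Big)+\frac{\sigma^2+\lambda^2}{|\mathsf T|^2}.$$ The infimum is over all partitions $P$ of $\mathsf T$ into rectangles and all $\theta\in\mathbb R^{\mathsf T}$ which on each $S\in P$ are given by a polynomial of degree at most $m$, $\theta_u=\sum_{|\mathbf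 m|\le m}\beta_{\mathbf m,S}\,u^{\mathbf m}$ for $u\in S$, and $s_{m,\infty}(\theta)=\max_{S\in P,\,|\mathbf m|\le m}n^{|\mathbf m|}\,|\beta_{\mathbf m,S}|$. Where $\theta$ has several such representations on $P$, the bound holds for every choice of the coefficients $\beta$. -/

import Mathlib

open MeasureTheory ProbabilityTheory
open scoped NNReal

noncomputable section

namespace OnlineAgg

/-! ### Online rules and the aggregation algorithm on a finite domain `K` -/

section Algorithm

variable {K : Type} [DecidableEq K] {N : ℕ}

/-- Online rules for all subsets `S` of `K` at once: `r S U s` is the map `ℝ^U → ℝ` by which the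
expert attached to `S` predicts at `s` after having seen the data on `U ⊆ S`. -/
abbrev OnlineRule (K : Type) : Type :=
  Finset K → (U : Finset K) → K → (U → ℝ) → ℝ

/-- Truncation `T_a(x) = min (max x (-a)) a`. -/
def trunc (a x : ℝ) : ℝ := min (max x (-a)) a

/-- The points revealed strictly before round `t`. Rounds are numbered `0, …, N - 1`. -/
def revealed [Fintype K] (ρ : Fin N ≃ K) (t : Fin N) : Finset K :=
  Finset.univ.filter fun u => ρ.symm u < t

/-- The prediction of the expert `S` at round `t`, i.e. at the point `ρ t`; it only uses the data
at the points of `S` revealed before round `t`. -/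
def expertPred [Fintype K] (r : OnlineRule K) (ρ : Fin N ≃ K) (y : K → ℝ) (S : Finset K)
    (t : Fin N) : ℝ :=
  r S (revealed ρ t ∩ S) (ρ t) fun u => y u

/-- The active experts at round `t`: those which contain `ρ t` and, unless `t` is the first round,
also contain some point revealed earlier. -/
def active (E : Finset (Finset K)) (ρ : Fin N ≃ K) (t : Fin N) : Finset (Finset K) :=
  E.filter fun S => ρ t ∈ S ∧ ((t : ℕ) = 0 ∨ ∃ t' : Fin N, t' < t ∧ ρ t' ∈ S)

/-- The loss of the expert `S` at round `t`. -/
def loss [Fintype K] (r : OnlineRule K) (lam : ℝ) (ρ : Fin N ≃ K) (y : K → ℝ) (S : Finset K)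
    (t : Fin N) : ℝ :=
  (trunc lam (y (ρ t)) - trunc lam (expertPred r ρ y S t)) ^ 2

/-- The weight of the expert `S` at the beginning of round `t`, with learning rate
`α = 1 / (8 λ²)`. -/
def weight [Fintype K] (r : OnlineRule K) (E : Finset (Finset K)) (lam : ℝ) (ρ : Fin N ≃ K)
    (y : K → ℝ) : ℕ → Finset K → ℝ
  | 0, _ => 1 / (E.card : ℝ)
  | t + 1, S =>
    if h : t < N then
      if S ∈ active E ρ ⟨t, h⟩ then
        weight r E lam ρ y t S * Real.exp (-(1 / (8 * lam ^ 2)) * loss r lam ρ y S ⟨t, h⟩)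
          / (∑ S' ∈ active E ρ ⟨t, h⟩, weight r E lam ρ y t S' *
              Real.exp (-(1 / (8 * lam ^ 2)) * loss r lam ρ y S' ⟨t, h⟩))
          * ∑ S' ∈ active E ρ ⟨t, h⟩, weight r E lam ρ y t S'
      else weight r E lam ρ y t S
    else weight r E lam ρ y t S

/-- The output of the aggregation algorithm with rule `r`, experts `E` and truncation parameter
`lam`, on the data `y` revealed in the order `ρ`: its prediction at the point `s`, which is
revealed at round `ρ.symm s`. -/
def aggregate [Fintype K] (r : OnlineRule K) (E : Finset (Finset K)) (lam : ℝ) (ρ : Fin N ≃ K)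
    (y : K → ℝ) (s : K) : ℝ :=
  ∑ S ∈ active E ρ (ρ.symm s),
    weight r E lam ρ y (ρ.symm s) S
        / (∑ S' ∈ active E ρ (ρ.symm s), weight r E lam ρ y (ρ.symm s) S')
      * trunc lam (expertPred r ρ y S (ρ.symm s))

/-- The Vovk–Azoury–Warmuth linear regression rule with feature vectors `x u`: the prediction at
`s` is `β · x s` with `β = (I + ∑_{u ∈ U ∪ {s}} x_u x_uᵀ)⁻¹ (∑_{u ∈ U} y_u x_u)`. -/
def vawRule {ι : Type} [Fintype ι] [DecidableEq ι] (x : K → ι → ℝ) : OnlineRule K :=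
  fun _S U s y =>
    ((1 + ∑ u ∈ insert s U, Matrix.vecMulVec (x u) (x u) : Matrix ι ι ℝ)⁻¹.mulVec
      (∑ u : U, y u • x u)) ⬝ᵥ x s

end Algorithm

/-! ### The lattice, rectangles and dyadic rectangles -/

/-- The lattice `{1, …, n}^d`; the `i`-th coordinate of `u` is the integer `(u i : ℕ) + 1`. -/
abbrev Grid (d n : ℕ) : Type := Fin d → Fin n

/-- A nonempty product of intervals `∏ [a i, b i]`. -/
def IsRectangle {d n : ℕ} (R : Finset (Grid d n)) : Prop :=
  ∃ a b : Fin d → Fin n, (∀ i, a i ≤ b i) ∧ R = Fintype.piFinset fun i => Finset.Icc (a i) (b i)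

/-- Intervals `(a 2^s, (a + 1) 2^s]` with `a, s ≥ 0` that are contained in `[1, n]`. -/
def IsDyadicInterval {n : ℕ} (I : Finset (Fin n)) : Prop :=
  ∃ s a : ℕ, (a + 1) * 2 ^ s ≤ n ∧
    I = Finset.univ.filter fun i : Fin n => a * 2 ^ s < (i : ℕ) + 1 ∧ (i : ℕ) + 1 ≤ (a + 1) * 2 ^ s

/-- Products of dyadic intervals. -/
def IsDyadicRectangle {d n : ℕ} (R : Finset (Grid d n)) : Prop :=
  ∃ I : Fin d → Finset (Fin n), (∀ i, IsDyadicInterval (I i)) ∧ R = Fintype.piFinset I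

open Classical in
/-- The set of all dyadic rectangles of the lattice. -/
def dyadicRectangles (d n : ℕ) : Finset (Finset (Grid d n)) :=
  Finset.univ.filter fun R => IsDyadicRectangle R

/-! ### Monomials and the OLRADRE predictor -/

/-- Multidegrees `(m₁, …, m_d)` of total degree at most `m` (each entry is then at most `m`). -/
abbrev MultiDeg (d m : ℕ) : Type :=
  {a : Fin d → Fin (m + 1) // ∑ i, (a i : ℕ) ≤ m}

/-- The total degree `m₁ + ⋯ + m_d`. -/
def MultiDeg.deg {d m : ℕ} (a : MultiDeg d m) : ℕ := ∑ i, (a.1 i : ℕ)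

/-- The monomial `u^𝐦 = ∏ u_i^{m_i}` at a lattice point. -/
def monomialAt {d n m : ℕ} (u : Grid d n) (a : MultiDeg d m) : ℝ :=
  ∏ i, (((u i : ℕ) : ℝ) + 1) ^ (a.1 i : ℕ)

/-- The feature vector of a lattice point: all rescaled monomials `(u / n)^𝐦`, `|𝐦| ≤ m`. -/
def feature (d n m : ℕ) (u : Grid d n) : MultiDeg d m → ℝ :=
  fun a => ∏ i, ((((u i : ℕ) : ℝ) + 1) / (n : ℝ)) ^ (a.1 i : ℕ)

/-- The OLRADRE predictor of degree `m`: aggregation, over all dyadic rectangles, of the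
Vovk–Azoury–Warmuth forecasters with the rescaled monomials of degree at most `m`. -/
def olradre (d n m : ℕ) {N : ℕ} (lam : ℝ) (ρ : Fin N ≃ Grid d n) (y : Grid d n → ℝ) :
    Grid d n → ℝ :=
  aggregate (vawRule (feature d n m)) (dyadicRectangles d n) lam ρ y

/-! ### Piecewise polynomials -/

/-- `θ` is on every piece `S ∈ P` the polynomial `∑ β S 𝐦 u^𝐦` of degree at most `m`. The values
of `θ` outside the pieces are irrelevant. -/
def IsPiecewisePoly {d n m : ℕ} (P : Finset (Finset (Grid d n)))
    (β : Finset (Grid d n) → MultiDeg d m → ℝ) (θ : Grid d n → ℝ) : Prop :=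
  ∀ S ∈ P, ∀ u ∈ S, θ u = ∑ a, β S a * monomialAt u a

/-- The largest rescaled coefficient `max_{S ∈ P, |𝐦| ≤ m} n^|𝐦| |β S 𝐦|`. -/
def coeffNorm {d n m : ℕ} (P : Finset (Finset (Grid d n)))
    (β : Finset (Grid d n) → MultiDeg d m → ℝ) : ℝ≥0 :=
  (P ×ˢ (Finset.univ : Finset (MultiDeg d m))).sup fun p => ‖(n : ℝ) ^ p.2.deg * β p.1 p.2‖₊

/-! ### Noise and orderings -/

section Probability

variable {Ω : Type*} [MeasurableSpace Ω] {K : Type} {N : ℕ}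

/-- Independent, mean zero entries with `max (P[ε ≥ x], P[ε ≤ -x]) ≤ 2 exp (-x² / 2)` for all
`x ≥ 0`. -/
structure IsSubGaussianNoise (μ : Measure Ω) (ε : K → Ω → ℝ) : Prop where
  measurable : ∀ s, Measurable (ε s)
  indep : iIndepFun ε μ
  mean_zero : ∀ s, ∫ ω, ε s ω ∂μ = 0
  tail_right : ∀ s, ∀ x : ℝ, 0 ≤ x → μ.real {ω | x ≤ ε s ω} ≤ 2 * Real.exp (-x ^ 2 / 2)
  tail_left : ∀ s, ∀ x : ℝ, 0 ≤ x → μ.real {ω | ε s ω ≤ -x} ≤ 2 * Real.exp (-x ^ 2 / 2)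

/-- The σ-algebra generated by the points `ρ` reveals up to and including round `t` and by the
data at the points revealed strictly before round `t`. -/
@[reducible]
def pastSigma (y : K → Ω → ℝ) (ρ : Ω → Fin N ≃ K) (t : Fin N) : MeasurableSpace Ω :=
  (⨆ j : Fin N, ⨆ _ : j ≤ t, MeasurableSpace.comap (fun ω => ρ ω j) ⊤) ⊔
    (⨆ j : Fin N, ⨆ _ : j < t,
      MeasurableSpace.comap (fun ω => y (ρ ω j) ω) (inferInstance : MeasurableSpace ℝ))

/-- A random ordering `ρ` is non-anticipating if, conditionally on the points revealed up to round
`t` and the data revealed before round `t`, the noise at `ρ(t)` is distributed as `ε s` on the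
event `ρ(t) = s`. -/
structure IsNonAnticipating (μ : Measure Ω) (ε y : K → Ω → ℝ) (ρ : Ω → Fin N ≃ K) : Prop where
  measurable : ∀ t s, MeasurableSet {ω | ρ ω t = s}
  cond_law : ∀ (t : Fin N) (s : K) (B : Set ℝ), MeasurableSet B →
    ∀ᵐ ω ∂μ, ρ ω t = s →
      (μ⟦{ω' | ε (ρ ω' t) ω' ∈ B} | pastSigma y ρ t⟧) ω = μ.real {ω' | ε s ω' ∈ B}

end Probability

end OnlineAgg

end

open OnlineAgg

set_option linter.unusedSectionVars false

namespace OnlineAgg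

/-! ### Aggregation of sleeping experts -/

section Aggregation

variable {K : Type} [DecidableEq K] {N : ℕ}

/-! The risk bound is an online regret bound averaged over the noise.

Suppose first that all data are at most λ in absolute value. The learning rate 1/(8λ²) makes the
square loss exp-concave on truncated values, so exponential weighting competes with every expert on
its own rectangle up to 8λ² log|E|, plus 4λ² for the one round at which the expert may be asleep
(`sum_sq_sub_aggregate_le`). The expert itself competes with every fixed coefficient vector up to a
ridge penalty and a log-determinant (`sum_sq_sub_expertPred_vawRule_le`). Hence the excess loss over
any fixed polynomial is controlled on every dyadic rectangle. Excess losses are additive over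
disjoint sets, and a rectangle splits into at most (2k+1)^d dyadic ones, so the control passes to
the pieces of a partition (`sum_rectangle_le`, `sum_sq_sub_olradre_sub_le`).

For the risk, write f for the prediction and expand (f - θ*)² = (θ* - θ)² + [(y - f)² - (y - θ)²] +
2σ(f - θ)ε. The last term has mean zero: f is a function of the past and the ordering is
non-anticipating (`integral_aggregate_mul_noise_eq_zero`). The bracket sums to the regret, which is
controlled when all data lie below λ. That fails only with polynomially small probability, and then
the fourth moment of the noise limits the damage (`integral_sum_sq_aggregate_sub_le`). -/

theorem concaveOn_exp_neg_mul_sq {a B : ℝ} (ha : 0 ≤ a) (h : 2 * a * B ^ 2 ≤ 1) :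
    ConcaveOn ℝ (Set.Icc (-B) B) fun x => Real.exp (-a * x ^ 2) := by
  have h1 (x : ℝ) : HasDerivAt (fun x => Real.exp (-a * x ^ 2))
      (Real.exp (-a * x ^ 2) * (-a * (2 * x))) x := by
    simpa using ((hasDerivAt_pow 2 x).const_mul (-a)).exp
  have h2 (x : ℝ) : HasDerivAt (fun x => Real.exp (-a * x ^ 2) * (-a * (2 * x)))
      (Real.exp (-a * x ^ 2) * (-a * (2 * x)) * (-a * (2 * x))
        + Real.exp (-a * x ^ 2) * (-a * (2 * 1))) x :=
    (h1 x).mul (((hasDerivAt_id x).const_mul 2).const_mul (-a))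
  refine concaveOn_of_hasDerivWithinAt2_nonpos (convex_Icc _ _) (by fun_prop)
    (fun x _ => (h1 x).hasDerivWithinAt) (fun x _ => (h2 x).hasDerivWithinAt) fun x hx => ?_
  rw [interior_Icc] at hx
  have hx2 : x ^ 2 ≤ B ^ 2 := sq_le_sq' hx.1.le hx.2.le
  -- The second derivative is exp(-ax²) · 2a · (2ax² - 1), so its sign is decided by 2ax² ≤ 1.
  have h3 : 2 * a * x ^ 2 ≤ 1 := (mul_le_mul_of_nonneg_left hx2 (by positivity)).trans h
  have h4 : (0 : ℝ) ≤ Real.exp (-a * x ^ 2) * (2 * a) := by positivity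
  nlinarith [mul_le_mul_of_nonneg_left h3 h4]

theorem abs_trunc_le {a : ℝ} (ha : 0 ≤ a) (x : ℝ) : |trunc a x| ≤ a := by
  unfold trunc
  rw [abs_le]
  exact ⟨le_min (le_max_right _ _) (by linarith), min_le_right _ _⟩

theorem trunc_eq_self {a x : ℝ} (h : |x| ≤ a) : trunc a x = x := by
  obtain ⟨h1, h2⟩ := abs_le.1 h
  rw [trunc, max_eq_left h1, min_eq_left h2]

theorem sq_sub_trunc_le {a z : ℝ} (hz : |z| ≤ a) (x : ℝ) : (z - trunc a x) ^ 2 ≤ (z - x) ^ 2 := by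
  obtain ⟨h1, h2⟩ := abs_le.1 hz
  unfold trunc
  rcases le_total x (-a) with h | h
  · rw [max_eq_right h, min_eq_left (by linarith)]
    nlinarith
  · rw [max_eq_left h]
    rcases le_total x a with h' | h'
    · rw [min_eq_left h']
    · rw [min_eq_right h']
      nlinarith

/-- Jensen's inequality. The differences z - x i lie in [-2λ, 2λ], and 1/(8λ²) is the largest rate
allowed there: 2 · (1/(8λ²)) · (2λ)² = 1. -/
theorem sum_mul_exp_neg_sq_le {ι : Type*} {s : Finset ι} {p x : ι → ℝ} {z lam : ℝ} (hlam : 0 < lam)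
    (hp : ∀ i ∈ s, 0 ≤ p i) (hp1 : ∑ i ∈ s, p i = 1) (hx : ∀ i ∈ s, |x i| ≤ lam)
    (hz : |z| ≤ lam) :
    ∑ i ∈ s, p i * Real.exp (-(1 / (8 * lam ^ 2)) * (z - x i) ^ 2)
      ≤ Real.exp (-(1 / (8 * lam ^ 2)) * (z - ∑ i ∈ s, p i * x i) ^ 2) := by
  have hc := concaveOn_exp_neg_mul_sq (a := 1 / (8 * lam ^ 2)) (B := 2 * lam) (by positivity)
    (le_of_eq (by field_simp; norm_num))
  have := hc.le_map_sum hp hp1 (p := fun i => z - x i) fun i hi => by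
    have h1 := abs_le.1 (hx i hi)
    have h2 := abs_le.1 hz
    constructor <;> linarith
  simp only [smul_eq_mul, mul_sub, Finset.sum_sub_distrib, ← Finset.sum_mul, hp1, one_mul] at this
  exact this

variable {E : Finset (Finset K)} {ρ : Fin N ≃ K}

theorem active_subset (t : Fin N) : active E ρ t ⊆ E := Finset.filter_subset _ _

/-- The expert `S` is active at all of its points but possibly the first one. -/
theorem exists_forall_ne_mem_active {S : Finset K} (hS : S ∈ E) (hne : S.Nonempty) :
    ∃ s₀ ∈ S, ∀ s ∈ S, s ≠ s₀ → S ∈ active E ρ (ρ.symm s) := by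
  obtain ⟨s₀, h0, hmin⟩ := S.exists_min_image ρ.symm hne
  refine ⟨s₀, h0, fun s hs hss => ?_⟩
  rw [active, Finset.mem_filter]
  refine ⟨hS, by simpa using hs, Or.inr ⟨ρ.symm s₀, lt_of_le_of_ne (hmin s hs) ?_, by simpa using h0⟩⟩
  simpa using hss.symm

variable [Fintype K] {r : OnlineRule K} {lam : ℝ} {y : K → ℝ}

theorem weight_succ_of_mem {t : Fin N} {S : Finset K} (hS : S ∈ active E ρ t) :
    weight r E lam ρ y (t + 1) S =
      weight r E lam ρ y t S * Real.exp (-(1 / (8 * lam ^ 2)) * loss r lam ρ y S t)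
        / (∑ S' ∈ active E ρ t, weight r E lam ρ y t S' *
            Real.exp (-(1 / (8 * lam ^ 2)) * loss r lam ρ y S' t))
        * ∑ S' ∈ active E ρ t, weight r E lam ρ y t S' := by
  rw [weight, dif_pos t.2, if_pos hS]

theorem weight_succ_of_notMem {t : Fin N} {S : Finset K} (hS : S ∉ active E ρ t) :
    weight r E lam ρ y (t + 1) S = weight r E lam ρ y t S := by
  rw [weight, dif_pos t.2, if_neg hS]

theorem weight_pos (hE : E.Nonempty) (t : ℕ) (S : Finset K) : 0 < weight r E lam ρ y t S := by
  induction t generalizing S with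
  | zero =>
    rw [weight]
    have := hE.card_pos
    positivity
  | succ t ih =>
    by_cases h : t < N
    · by_cases hS : S ∈ active E ρ ⟨t, h⟩
      · have := weight_succ_of_mem (r := r) (lam := lam) (y := y) hS
        dsimp only at this
        rw [this]
        refine mul_pos (div_pos (mul_pos (ih S) (Real.exp_pos _)) ?_) ?_
        · exact Finset.sum_pos (fun S' _ => mul_pos (ih S') (Real.exp_pos _)) ⟨S, hS⟩
        · exact Finset.sum_pos (fun S' _ => ih S') ⟨S, hS⟩
      · have := weight_succ_of_notMem (r := r) (lam := lam) (y := y) hS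
        dsimp only at this
        rw [this]
        exact ih S
    · rw [weight, dif_neg h]
      exact ih S

theorem weight_nonneg (t : ℕ) {S : Finset K} (hS : S ∈ E) : 0 ≤ weight r E lam ρ y t S :=
  (weight_pos ⟨S, hS⟩ t S).le

/-- The normalization redistributes mass among the awake experts only. This keeps the total mass
equal to 1 whichever experts sleep, so no weight ever exceeds 1. -/
theorem sum_weight_succ (hE : E.Nonempty) (t : Fin N) :
    ∑ S ∈ active E ρ t, weight r E lam ρ y (t + 1) S
      = ∑ S ∈ active E ρ t, weight r E lam ρ y t S := by
  rcases (active E ρ t).eq_empty_or_nonempty with h | h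
  · simp [h]
  rw [Finset.sum_congr rfl fun S hS => weight_succ_of_mem hS, ← Finset.sum_mul, ← Finset.sum_div,
    div_self, one_mul]
  exact (Finset.sum_pos (fun S' _ => mul_pos (weight_pos hE _ S') (Real.exp_pos _)) h).ne'

theorem sum_weight (hE : E.Nonempty) (t : ℕ) : ∑ S ∈ E, weight r E lam ρ y t S = 1 := by
  induction t with
  | zero =>
    have := hE.card_pos
    simp only [weight, Finset.sum_const, nsmul_eq_mul]
    field_simp
  | succ t ih =>
    by_cases h : t < N
    · rw [← ih, ← Finset.sum_sdiff (active_subset (E := E) (ρ := ρ) ⟨t, h⟩),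
        ← Finset.sum_sdiff (active_subset (E := E) (ρ := ρ) ⟨t, h⟩)]
      congr 1
      · exact Finset.sum_congr rfl fun S hS =>
          weight_succ_of_notMem (t := ⟨t, h⟩) (Finset.mem_sdiff.1 hS).2
      · exact sum_weight_succ hE ⟨t, h⟩
    · rw [← ih]
      exact Finset.sum_congr rfl fun S _ => by rw [weight, dif_neg h]

theorem weight_le_one (t : ℕ) {S : Finset K} (hS : S ∈ E) : weight r E lam ρ y t S ≤ 1 := by
  rw [← sum_weight (r := r) (lam := lam) (ρ := ρ) (y := y) ⟨S, hS⟩ t]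
  exact Finset.single_le_sum (f := weight r E lam ρ y t) (fun S' hS' => weight_nonneg t hS') hS

theorem abs_aggregate_le (hlam : 0 ≤ lam) (s : K) : |aggregate r E lam ρ y s| ≤ lam := by
  set t := ρ.symm s with ht
  have hw : ∀ S ∈ active E ρ t, 0 ≤ weight r E lam ρ y t S := fun S hS =>
    weight_nonneg _ (active_subset t hS)
  calc |aggregate r E lam ρ y s|
      ≤ ∑ S ∈ active E ρ t, |weight r E lam ρ y t S
          / (∑ S' ∈ active E ρ t, weight r E lam ρ y t S')
            * trunc lam (expertPred r ρ y S t)| := Finset.abs_sum_le_sum_abs _ _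
    _ ≤ ∑ S ∈ active E ρ t, weight r E lam ρ y t S
          / (∑ S' ∈ active E ρ t, weight r E lam ρ y t S') * lam := by
        refine Finset.sum_le_sum fun S hS => ?_
        have h1 : 0 ≤ weight r E lam ρ y t S / (∑ S' ∈ active E ρ t, weight r E lam ρ y t S') :=
          div_nonneg (hw S hS) (Finset.sum_nonneg hw)
        rw [abs_mul, abs_of_nonneg h1]
        exact mul_le_mul_of_nonneg_left (abs_trunc_le hlam _) h1
    _ ≤ lam := by
        rw [← Finset.sum_mul, ← Finset.sum_div]
        exact mul_le_of_le_one_left hlam (div_self_le_one _)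

/-- With W and Z the active mass before and after exponential damping, exp-concavity bounds the
aggregate's loss by -8λ² log(Z/W). The update multiplies the weight of S by e^{-ℓ/(8λ²)} W/Z, so the
log-weight increment is exactly what remains after subtracting ℓ. -/
theorem sq_sub_aggregate_sub_loss_le (hlam : 0 < lam) {t : Fin N} {S : Finset K}
    (hS : S ∈ active E ρ t) :
    (trunc lam (y (ρ t)) - aggregate r E lam ρ y (ρ t)) ^ 2 - loss r lam ρ y S t
      ≤ 8 * lam ^ 2 *
        (Real.log (weight r E lam ρ y (t + 1) S) - Real.log (weight r E lam ρ y t S)) := by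
  have hE : E.Nonempty := ⟨S, active_subset t hS⟩
  have hpos := weight_pos (r := r) (lam := lam) (ρ := ρ) (y := y) hE (t : ℕ)
  set W := ∑ S' ∈ active E ρ t, weight r E lam ρ y t S' with hW
  set Z := ∑ S' ∈ active E ρ t, weight r E lam ρ y t S' *
            Real.exp (-(1 / (8 * lam ^ 2)) * loss r lam ρ y S' t) with hZ
  have hW0 : 0 < W := Finset.sum_pos (fun S' _ => hpos S') ⟨S, hS⟩
  have hZ0 : 0 < Z := Finset.sum_pos (fun S' _ => mul_pos (hpos S') (Real.exp_pos _)) ⟨S, hS⟩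
  have key : Z / W ≤ Real.exp (-(1 / (8 * lam ^ 2)) *
      (trunc lam (y (ρ t)) - aggregate r E lam ρ y (ρ t)) ^ 2) := by
    have := sum_mul_exp_neg_sq_le (s := active E ρ t) (p := fun S' => weight r E lam ρ y t S' / W)
      (x := fun S' => trunc lam (expertPred r ρ y S' t)) (z := trunc lam (y (ρ t))) hlam
      (fun S' _ => div_nonneg (hpos S').le hW0.le) (by rw [← Finset.sum_div, div_self hW0.ne'])
      (fun S' _ => abs_trunc_le hlam.le _) (abs_trunc_le hlam.le _)
    rw [hZ, Finset.sum_div]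
    unfold aggregate
    rw [Equiv.symm_apply_apply]
    refine le_trans (le_of_eq (Finset.sum_congr rfl fun S' _ => ?_)) this
    rw [loss]
    ring
  have key2 := Real.log_le_log (div_pos hZ0 hW0) key
  rw [Real.log_exp, Real.log_div hZ0.ne' hW0.ne'] at key2
  rw [weight_succ_of_mem hS, ← hW, ← hZ, Real.log_mul (by positivity [hpos S]) hW0.ne',
    Real.log_div (mul_pos (hpos S) (Real.exp_pos _)).ne' hZ0.ne',
    Real.log_mul (hpos S).ne' (Real.exp_pos _).ne', Real.log_exp]
  set q := (trunc lam (y (ρ t)) - aggregate r E lam ρ y (ρ t)) ^ 2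
  have h8 : (0 : ℝ) < 8 * lam ^ 2 := by positivity
  have := mul_le_mul_of_nonneg_left key2 h8.le
  have e1 (u : ℝ) : 8 * lam ^ 2 * (-(1 / (8 * lam ^ 2)) * u) = -u := by field_simp
  rw [e1] at this
  have e2 := e1 (loss r lam ρ y S t)
  linear_combination this - e2

/-- The log-weights telescope from -log|E| to a value at most 0; rounds at which S sleeps leave its
weight unchanged. -/
theorem sum_regret_active_le (hlam : 0 < lam) {S : Finset K} (hS : S ∈ E) :
    ∑ t : Fin N, (if S ∈ active E ρ t then
        (trunc lam (y (ρ t)) - aggregate r E lam ρ y (ρ t)) ^ 2 - loss r lam ρ y S t else 0)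
      ≤ 8 * lam ^ 2 * Real.log E.card := by
  have step (t : Fin N) : (if S ∈ active E ρ t then
        (trunc lam (y (ρ t)) - aggregate r E lam ρ y (ρ t)) ^ 2 - loss r lam ρ y S t else 0)
      ≤ (fun j : ℕ => 8 * lam ^ 2 * (Real.log (weight r E lam ρ y (j + 1) S)
          - Real.log (weight r E lam ρ y j S))) t := by
    split_ifs with h
    · exact sq_sub_aggregate_sub_loss_le hlam h
    · simp [weight_succ_of_notMem h]
  refine (Finset.sum_le_sum fun t _ => step t).trans ?_
  rw [Fin.sum_univ_eq_sum_range (fun j : ℕ => 8 * lam ^ 2 *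
    (Real.log (weight r E lam ρ y (j + 1) S) - Real.log (weight r E lam ρ y j S))),
    ← Finset.mul_sum, Finset.sum_range_sub (fun j => Real.log (weight r E lam ρ y j S))]
  refine mul_le_mul_of_nonneg_left ?_ (by positivity)
  have h0 : Real.log (weight r E lam ρ y 0 S) = -Real.log E.card := by
    rw [weight, one_div, Real.log_inv]
  have h1 : Real.log (weight r E lam ρ y N S) ≤ 0 :=
    Real.log_nonpos (weight_nonneg N hS) (weight_le_one N hS)
  linarith

/-- Regret of the aggregate against the expert `S` for data bounded by the truncation level. -/
theorem sum_sq_sub_aggregate_le (hlam : 0 < lam) (hy : ∀ s, |y s| ≤ lam) {S : Finset K}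
    (hS : S ∈ E) :
    ∑ s ∈ S, (y s - aggregate r E lam ρ y s) ^ 2
      ≤ ∑ s ∈ S, (y s - expertPred r ρ y S (ρ.symm s)) ^ 2
        + 8 * lam ^ 2 * Real.log E.card + 4 * lam ^ 2 := by
  rcases S.eq_empty_or_nonempty with rfl | hne
  · have : 0 ≤ Real.log E.card := Real.log_natCast_nonneg _
    simp only [Finset.sum_empty]
    positivity
  obtain ⟨s₀, h0, hact⟩ := exists_forall_ne_mem_active (ρ := ρ) hS hne
  have hreg := sum_regret_active_le (r := r) (ρ := ρ) (y := y) hlam hS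
  rw [← ρ.symm.sum_comp] at hreg
  simp only [Equiv.apply_symm_apply, loss, trunc_eq_self (hy _)] at hreg
  have hsub : ∑ s ∈ S, (if S ∈ active E ρ (ρ.symm s) then (y s - aggregate r E lam ρ y s) ^ 2
      - (y s - trunc lam (expertPred r ρ y S (ρ.symm s))) ^ 2 else 0)
      = ∑ s, (if S ∈ active E ρ (ρ.symm s) then (y s - aggregate r E lam ρ y s) ^ 2
      - (y s - trunc lam (expertPred r ρ y S (ρ.symm s))) ^ 2 else 0) := by
    refine Finset.sum_subset (Finset.subset_univ _) fun s _ hs => if_neg fun h => hs ?_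
    simpa using (Finset.mem_filter.1 h).2.1
  rw [← hsub] at hreg
  -- Only at `s₀`, the first point of S to be revealed, can S be asleep. There data and aggregate
  -- are both at most λ in absolute value, which costs at most (2λ)².
  have hpt : ∀ s ∈ S, (y s - aggregate r E lam ρ y s) ^ 2 - (y s - expertPred r ρ y S (ρ.symm s)) ^ 2
      ≤ (if S ∈ active E ρ (ρ.symm s) then (y s - aggregate r E lam ρ y s) ^ 2
      - (y s - trunc lam (expertPred r ρ y S (ρ.symm s))) ^ 2 else 0)
        + if s = s₀ then 4 * lam ^ 2 else 0 := by
    intro s hs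
    have ht := sq_sub_trunc_le (hy s) (expertPred r ρ y S (ρ.symm s))
    by_cases ha : S ∈ active E ρ (ρ.symm s)
    · rw [if_pos ha]
      have : (0 : ℝ) ≤ if s = s₀ then 4 * lam ^ 2 else 0 := by split_ifs <;> positivity
      linarith
    · have hs0 : s = s₀ := by
        by_contra h
        exact ha (hact s hs h)
      rw [if_neg ha, if_pos hs0]
      have h1 := abs_le.1 (abs_aggregate_le (r := r) (E := E) (ρ := ρ) (y := y) hlam.le s)
      have h2 := abs_le.1 (hy s)
      nlinarith [sq_nonneg (y s - expertPred r ρ y S (ρ.symm s))]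
  have := Finset.sum_le_sum hpt
  rw [Finset.sum_sub_distrib, Finset.sum_add_distrib, Finset.sum_ite_eq' S s₀, if_pos h0] at this
  linarith

end Aggregation

/-! ### Regret of the Vovk–Azoury–Warmuth forecaster -/

section VAW

open Matrix

variable {K : Type} [DecidableEq K] {ι : Type} [Fintype ι] [DecidableEq ι]

/-- The quadratic form of A is nonnegative at v - A⁻¹b; the right side is the maximum over v of the
left. -/
theorem PosDef.le_dotProduct_inv_mulVec {A : Matrix ι ι ℝ} (hA : A.PosDef) (b v : ι → ℝ) :
    2 * (b ⬝ᵥ v) - v ⬝ᵥ (A *ᵥ v) ≤ b ⬝ᵥ (A⁻¹ *ᵥ b) := by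
  set w := A⁻¹ *ᵥ b with hw
  have hAw : A *ᵥ w = b := by
    rw [hw, mulVec_mulVec, mul_nonsing_inv A ((isUnit_iff_isUnit_det A).1 hA.isUnit), one_mulVec]
  have hs : w ⬝ᵥ (A *ᵥ v) = b ⬝ᵥ v := by
    have hT : Aᵀ = A := by simpa using hA.isHermitian.eq
    rw [dotProduct_mulVec, ← mulVec_transpose, hT, hAw]
  have := hA.posSemidef.dotProduct_mulVec_nonneg (v - w)
  simp only [star_trivial, mulVec_sub, dotProduct_sub, sub_dotProduct, hAw, hs] at this
  rw [dotProduct_comm v b, dotProduct_comm w b] at this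
  linarith

/-- The matrix determinant lemma gives det A = det B · (1 - q), where B is the updated matrix and q
the left side; then log(1 - q) ≤ -q. -/
theorem PosDef.dotProduct_inv_le_log_det_sub {A : Matrix ι ι ℝ} {x : ι → ℝ} (hA : A.PosDef)
    (hA' : (A + vecMulVec x x).PosDef) :
    x ⬝ᵥ ((A + vecMulVec x x)⁻¹ *ᵥ x) ≤ Real.log (A + vecMulVec x x).det - Real.log A.det := by
  set B := A + vecMulVec x x with hB
  have hdet : A.det = B.det * (1 - x ⬝ᵥ (B⁻¹ *ᵥ x)) := by
    have h1 : A = B + replicateCol Unit (-x) * replicateRow Unit x := by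
      rw [← vecMulVec_eq, neg_vecMulVec, hB, add_neg_cancel_right]
    conv_lhs => rw [h1]
    rw [det_add_replicateCol_mul_replicateRow ((isUnit_iff_isUnit_det B).1 hA'.isUnit)]
    congr 1
    rw [det_unique, Matrix.add_apply, one_apply_eq, Matrix.mul_assoc, ← replicateCol_mulVec,
      replicateRow_mul_replicateCol_apply, mulVec_neg, dotProduct_neg]
    ring
  have hq : 0 < 1 - x ⬝ᵥ (B⁻¹ *ᵥ x) := by
    have := hA.det_pos
    rw [hdet] at this
    exact pos_of_mul_pos_right this hA'.det_pos.le
  rw [hdet, Real.log_mul hA'.det_pos.ne' hq.ne']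
  have := Real.log_le_sub_one_of_pos hq
  linarith

/-- All eigenvalues are positive, so each is at most their sum. -/
theorem PosDef.log_det_le {A : Matrix ι ι ℝ} (hA : A.PosDef) :
    Real.log A.det ≤ Fintype.card ι * Real.log A.trace := by
  have hev := hA.eigenvalues_pos
  rw [hA.isHermitian.det_eq_prod_eigenvalues, hA.isHermitian.trace_eq_sum_eigenvalues]
  simp only [RCLike.ofReal_real_eq_id, id]
  rw [Real.log_prod fun i _ => (hev i).ne', ← nsmul_eq_mul, ← Finset.card_univ]
  refine Finset.sum_le_card_nsmul _ _ _ fun i _ => Real.log_le_log (hev i) ?_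
  exact Finset.single_le_sum (f := hA.isHermitian.eigenvalues) (fun j _ => (hev j).le)
    (Finset.mem_univ i)

/-- The regularized Gram matrix of the features on `V`. -/
def gram (x : K → ι → ℝ) (V : Finset K) : Matrix ι ι ℝ :=
  1 + ∑ u ∈ V, vecMulVec (x u) (x u)

theorem gram_posDef (x : K → ι → ℝ) (V : Finset K) : (gram x V).PosDef :=
  PosDef.one.add_posSemidef (posSemidef_sum _ fun u _ => by
    simpa using posSemidef_vecMulVec_self_star (x u))

theorem gram_insert (x : K → ι → ℝ) {V : Finset K} {s : K} (hs : s ∉ V) :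
    gram x (insert s V) = gram x V + vecMulVec (x s) (x s) := by
  rw [gram, gram, Finset.sum_insert hs, add_assoc, add_comm (vecMulVec _ _)]

theorem dotProduct_gram_mulVec (x : K → ι → ℝ) (V : Finset K) (v : ι → ℝ) :
    v ⬝ᵥ (gram x V *ᵥ v) = v ⬝ᵥ v + ∑ u ∈ V, (x u ⬝ᵥ v) ^ 2 := by
  rw [gram, add_mulVec, one_mulVec, dotProduct_add, sum_mulVec, dotProduct_sum]
  congr 1
  refine Finset.sum_congr rfl fun u _ => ?_
  rw [vecMulVec_mulVec]
  rw [dotProduct_smul, dotProduct_comm v, op_smul_eq_smul, smul_eq_mul, sq]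

theorem trace_gram_le {x : K → ι → ℝ} (hx : ∀ u i, |x u i| ≤ 1) (V : Finset K) :
    (gram x V).trace ≤ Fintype.card ι * (1 + V.card) := by
  rw [gram, trace_add, trace_one, trace_sum, mul_add, mul_one]
  gcongr
  rw [mul_comm, ← nsmul_eq_mul]
  refine Finset.sum_le_card_nsmul _ _ _ fun u _ => ?_
  rw [trace_vecMulVec, dotProduct, ← Finset.card_univ, ← nsmul_one]
  refine Finset.sum_le_card_nsmul _ _ _ fun i _ => ?_
  rw [← abs_mul_abs_self]
  exact mul_le_one₀ (hx u i) (abs_nonneg _) (hx u i)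

theorem log_det_gram_le [Nonempty ι] {x : K → ι → ℝ} (hx : ∀ u i, |x u i| ≤ 1) (V : Finset K) :
    Real.log (gram x V).det ≤ Fintype.card ι * Real.log (Fintype.card ι * (1 + V.card)) :=
  (PosDef.log_det_le (gram_posDef x V)).trans <| by
    gcongr
    · exact (gram_posDef x V).trace_pos
    · exact trace_gram_le hx V

/-- The vector `∑ y_u x_u` of correlations of the data with the features. -/
def corr (x : K → ι → ℝ) (y : K → ℝ) (V : Finset K) : ι → ℝ := ∑ u ∈ V, y u • x u

theorem corr_insert (x : K → ι → ℝ) (y : K → ℝ) {V : Finset K} {s : K} (hs : s ∉ V) :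
    corr x y (insert s V) = corr x y V + y s • x s := by
  rw [corr, corr, Finset.sum_insert hs, add_comm]

theorem corr_dotProduct (x : K → ι → ℝ) (y : K → ℝ) (V : Finset K) (v : ι → ℝ) :
    corr x y V ⬝ᵥ v = ∑ u ∈ V, y u * (x u ⬝ᵥ v) := by
  simp [corr, sum_dotProduct]

/-- The maximal decrease `b · A⁻¹ b` of the penalized sum of squares on `V`. -/
noncomputable def explained (x : K → ι → ℝ) (y : K → ℝ) (V : Finset K) : ℝ :=
  corr x y V ⬝ᵥ ((gram x V)⁻¹ *ᵥ corr x y V)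

theorem sum_sq_sub_explained_le (x : K → ι → ℝ) (y : K → ℝ) (V : Finset K) (v : ι → ℝ) :
    ∑ u ∈ V, y u ^ 2 - explained x y V ≤ ∑ u ∈ V, (y u - x u ⬝ᵥ v) ^ 2 + v ⬝ᵥ v := by
  have h1 := PosDef.le_dotProduct_inv_mulVec (gram_posDef x V) (corr x y V) v
  have h2 : ∑ u ∈ V, (y u - x u ⬝ᵥ v) ^ 2
      = ∑ u ∈ V, y u ^ 2 - 2 * ∑ u ∈ V, y u * (x u ⬝ᵥ v) + ∑ u ∈ V, (x u ⬝ᵥ v) ^ 2 := by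
    rw [Finset.mul_sum, ← Finset.sum_sub_distrib, ← Finset.sum_add_distrib]
    exact Finset.sum_congr rfl fun u _ => by ring
  rw [dotProduct_gram_mulVec, corr_dotProduct] at h1
  rw [h2, explained]
  linarith

theorem vawRule_eq (x : K → ι → ℝ) (y : K → ℝ) (S V : Finset K) (s : K) :
    vawRule x S V s (fun u => y u) = ((gram x (insert s V))⁻¹ *ᵥ corr x y V) ⬝ᵥ x s := by
  rw [vawRule, gram, corr, Finset.sum_coe_sort V (fun u => y u • x u)]

/-- One round of a potential argument whose potential is the ridge minimum plus λ² times the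
log-determinant. Because the Gram matrix already contains the current point, the step leaves only
the error y² q, with q the leverage of the new feature, and the log-determinant pays for it. -/
theorem sq_sub_vawRule_le (x : K → ι → ℝ) (y : K → ℝ) {lam : ℝ} (S : Finset K) {V : Finset K}
    {s : K} (hs : s ∉ V) (hy : |y s| ≤ lam) :
    (y s - vawRule x S V s fun u => y u) ^ 2
      ≤ y s ^ 2 - explained x y (insert s V) + explained x y V
        + lam ^ 2 * (Real.log (gram x (insert s V)).det - Real.log (gram x V).det) := by
  have hA := gram_posDef x V
  have hB := gram_posDef x (insert s V)
  set B := gram x (insert s V) with hBdef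
  set A := gram x V with hAdef
  set b := corr x y V with hb
  have hBA : B = A + vecMulVec (x s) (x s) := gram_insert x hs
  set v := B⁻¹ *ᵥ b with hv
  have hBv : B *ᵥ v = b := by
    rw [hv, mulVec_mulVec, mul_nonsing_inv B ((isUnit_iff_isUnit_det B).1 hB.isUnit), one_mulVec]
  have hBT : (B⁻¹)ᵀ = B⁻¹ := by simpa using hB.inv.isHermitian.eq
  have hpred : (vawRule x S V s fun u => y u) = v ⬝ᵥ x s := vawRule_eq x y S V s
  have hsym : b ⬝ᵥ (B⁻¹ *ᵥ x s) = v ⬝ᵥ x s := by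
    rw [dotProduct_mulVec, ← mulVec_transpose, hBT]
  have hq := PosDef.dotProduct_inv_le_log_det_sub hA (hBA ▸ hB)
  rw [← hBA] at hq
  have hq0 : 0 ≤ x s ⬝ᵥ (B⁻¹ *ᵥ x s) := by
    simpa using hB.inv.posSemidef.dotProduct_mulVec_nonneg (x s)
  have hexp : explained x y (insert s V)
      = b ⬝ᵥ v + 2 * y s * (v ⬝ᵥ x s) + y s ^ 2 * (x s ⬝ᵥ (B⁻¹ *ᵥ x s)) := by
    rw [explained, corr_insert x y hs, mulVec_add, mulVec_smul, dotProduct_add, add_dotProduct,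
      add_dotProduct, dotProduct_smul, dotProduct_smul, smul_dotProduct, smul_dotProduct, hsym,
      ← hv, dotProduct_comm (x s) v]
    simp only [smul_eq_mul]
    ring
  -- Testing the old ridge problem at the forecaster's coefficients v yields the term (v · x)² that
  -- completes the square (y - v · x)².
  have hvar := PosDef.le_dotProduct_inv_mulVec hA b v
  have hvA : v ⬝ᵥ (A *ᵥ v) = b ⬝ᵥ v - (v ⬝ᵥ x s) ^ 2 := by
    have : v ⬝ᵥ (B *ᵥ v) = v ⬝ᵥ (A *ᵥ v) + (v ⬝ᵥ x s) ^ 2 := by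
      rw [dotProduct_gram_mulVec, dotProduct_gram_mulVec, Finset.sum_insert hs,
        dotProduct_comm (x s)]
      ring
    rw [hBv, dotProduct_comm] at this
    linarith
  have hys : y s ^ 2 ≤ lam ^ 2 := sq_le_sq' (abs_le.1 hy).1 (abs_le.1 hy).2
  rw [hpred, hexp]
  have h3 : explained x y V = b ⬝ᵥ (A⁻¹ *ᵥ b) := rfl
  have h4 : y s ^ 2 * (x s ⬝ᵥ (B⁻¹ *ᵥ x s)) ≤ lam ^ 2 * (Real.log B.det - Real.log A.det) :=
    mul_le_mul hys hq hq0 (sq_nonneg _)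
  rw [h3]
  linarith

variable [Fintype K] {N : ℕ}

theorem sum_sq_sub_expertPred_vawRule_le [Nonempty ι] {x : K → ι → ℝ} (hx : ∀ u i, |x u i| ≤ 1)
    {y : K → ℝ} {lam : ℝ} (hy : ∀ u, |y u| ≤ lam) (ρ : Fin N ≃ K) (S : Finset K) (v : ι → ℝ) :
    ∑ s ∈ S, (y s - expertPred (vawRule x) ρ y S (ρ.symm s)) ^ 2
      ≤ ∑ s ∈ S, (y s - x s ⬝ᵥ v) ^ 2 + v ⬝ᵥ v
        + lam ^ 2 * (Fintype.card ι * Real.log (Fintype.card ι * (1 + S.card))) := by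
  -- Telescoping over rounds; rounds outside S change nothing, and both potentials vanish at the
  -- start because the Gram matrix is then the identity.
  have main (t : ℕ) (ht : t ≤ N) :
      ∑ s ∈ S with (ρ.symm s : ℕ) < t, (y s - expertPred (vawRule x) ρ y S (ρ.symm s)) ^ 2
      ≤ ∑ s ∈ S with (ρ.symm s : ℕ) < t, y s ^ 2
        - explained x y (S.filter fun s => (ρ.symm s : ℕ) < t)
        + lam ^ 2 * Real.log (gram x (S.filter fun s => (ρ.symm s : ℕ) < t)).det := by
    induction t with
    | zero => simp [explained, corr, gram]
    | succ t ih =>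
      have htN : t < N := ht
      specialize ih htN.le
      set s := ρ ⟨t, htN⟩ with hs
      have hst : (ρ.symm s : ℕ) = t := by simp [hs]
      have hiff (u : K) : (ρ.symm u : ℕ) < t + 1 ↔ (u = s ∨ (ρ.symm u : ℕ) < t) := by
        rw [Nat.lt_succ_iff_lt_or_eq, or_comm]
        refine or_congr ⟨fun h => ρ.symm.injective (Fin.ext (h.trans hst.symm)), ?_⟩ Iff.rfl
        rintro rfl
        exact hst
      by_cases hsS : s ∈ S
      · have hnot : s ∉ S.filter fun u => (ρ.symm u : ℕ) < t := by simp [hst]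
        have hins : (S.filter fun u => (ρ.symm u : ℕ) < t + 1)
            = insert s (S.filter fun u => (ρ.symm u : ℕ) < t) := by
          ext u
          simp only [Finset.mem_filter, Finset.mem_insert, hiff]
          constructor
          · rintro ⟨h1, h2 | h2⟩
            · exact Or.inl h2
            · exact Or.inr ⟨h1, h2⟩
          · rintro (rfl | h)
            · exact ⟨hsS, Or.inl rfl⟩
            · exact ⟨h.1, Or.inr h.2⟩
        have hrev : revealed ρ (ρ.symm s) ∩ S = S.filter fun u => (ρ.symm u : ℕ) < t := by
          ext u
          simp only [revealed, Finset.mem_inter, Finset.mem_filter, Finset.mem_univ, true_and,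
            Fin.lt_def, hst, and_comm]
        have hstep := sq_sub_vawRule_le x y S hnot (hy s)
        rw [hins, Finset.sum_insert hnot, Finset.sum_insert hnot]
        simp only [expertPred] at ih ⊢
        rw [hrev, Equiv.apply_symm_apply]
        linarith
      · have hins : (S.filter fun u => (ρ.symm u : ℕ) < t + 1)
            = S.filter fun u => (ρ.symm u : ℕ) < t := by
          refine Finset.filter_congr fun u hu => ?_
          rw [hiff]
          exact or_iff_right (fun h => hsS (h ▸ hu))
        rw [hins]
        exact ih
  have hall : (S.filter fun s => (ρ.symm s : ℕ) < N) = S :=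
    Finset.filter_true_of_mem fun s _ => (ρ.symm s).2
  have h1 := main N le_rfl
  rw [hall] at h1
  have h2 := sum_sq_sub_explained_le x y S v
  have h3 := mul_le_mul_of_nonneg_left (log_det_gram_le hx S) (sq_nonneg lam)
  linarith

end VAW

/-! ### Dyadic rectangles -/

section Dyadic

/-- The part of `Fin n` that corresponds to the lattice points in `(a, b]`. -/
abbrev finIoc (n a b : ℕ) : Finset (Fin n) :=
  Finset.univ.filter fun i : Fin n => a < (i : ℕ) + 1 ∧ (i : ℕ) + 1 ≤ b

theorem mem_finIoc {n a b : ℕ} {i : Fin n} :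
    i ∈ finIoc n a b ↔ a < (i : ℕ) + 1 ∧ (i : ℕ) + 1 ≤ b := by
  simp [finIoc]

theorem finIoc_self (n c : ℕ) : finIoc n c c = ∅ :=
  Finset.filter_false_of_mem fun i _ => by omega

theorem sum_finIoc_split {n : ℕ} (g : Fin n → ℝ) {a b c : ℕ} (hab : a ≤ b) (hbc : b ≤ c) :
    ∑ i ∈ finIoc n a c, g i
      = ∑ i ∈ finIoc n a b, g i
        + ∑ i ∈ finIoc n b c, g i := by
  rw [← Finset.sum_union]
  · refine Finset.sum_congr ?_ fun _ _ => rfl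
    ext i
    simp only [Finset.mem_union, mem_finIoc]
    omega
  · rw [Finset.disjoint_left]
    intro i
    simp only [mem_finIoc]
    omega

/-- A bound for the sums over dyadic intervals gives one for the sums over the intervals
`(a 2 ^ s, b 2 ^ s]` with `b ≤ 2 ^ j`. -/
theorem sum_finIoc_le {n : ℕ} {g : Fin n → ℝ} {B : ℝ} (hB : 0 ≤ B)
    (hg : ∀ I, IsDyadicInterval I → ∑ i ∈ I, g i ≤ B) (j : ℕ) :
    ∀ s a b : ℕ, a ≤ b → b ≤ 2 ^ j → b * 2 ^ s ≤ n →
      ∑ i ∈ finIoc n (a * 2 ^ s) (b * 2 ^ s), g i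
        ≤ (2 * j + 1) * B := by
  have hdy (s a : ℕ) (h : (a + 1) * 2 ^ s ≤ n) :
      ∑ i ∈ finIoc n (a * 2 ^ s) ((a + 1) * 2 ^ s), g i ≤ B :=
    hg _ ⟨s, a, h, rfl⟩
  have hempty (c : ℕ) : ∑ i ∈ finIoc n c c, g i = 0 := by
    rw [finIoc_self, Finset.sum_empty]
  induction j with
  | zero =>
    intro s a b hab hb hbn
    rw [pow_zero] at hb
    rcases hab.eq_or_lt with rfl | hlt
    · rw [hempty]
      positivity
    · obtain rfl : b = a + 1 := by omega
      simpa using hdy s a hbn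
  | succ j ih =>
    intro s a b hab hb hbn
    have hb' : b ≤ 2 * 2 ^ j := by rw [pow_succ'] at hb; exact hb
    have hpow (c : ℕ) : c * 2 ^ (s + 1) = 2 * c * 2 ^ s := by ring
    rcases hab.eq_or_lt with rfl | hlt
    · rw [hempty]
      positivity
    -- Both endpoints are rounded inward to even multiples. At most one cell of scale s is cut off
    -- at each end, and the possibly empty middle lives at scale s + 1; hence 2 more terms per step.
    -- The strict inequality a < b ensures a' ≤ b'.
    set a' := (a + 1) / 2 with ha'
    set b' := b / 2 with hb''
    have hmono {p q : ℕ} (h : p ≤ q) : p * 2 ^ s ≤ q * 2 ^ s := Nat.mul_le_mul_right _ h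
    have hmid := ih (s + 1) a' b' (by omega) (by omega)
      (by rw [hpow]; exact (hmono (by omega)).trans hbn)
    rw [hpow, hpow] at hmid
    have hleft : ∑ i ∈ finIoc n (a * 2 ^ s) (2 * a' * 2 ^ s), g i
        ≤ B := by
      rcases (show 2 * a' = a ∨ 2 * a' = a + 1 by omega) with h | h
      · rw [h, hempty]
        exact hB
      · rw [h]
        exact hdy s a ((hmono (by omega)).trans hbn)
    have hright : ∑ i ∈ finIoc n (2 * b' * 2 ^ s) (b * 2 ^ s), g i
        ≤ B := by
      rcases (show b = 2 * b' ∨ b = 2 * b' + 1 by omega) with h | h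
      · rw [← h, hempty]
        exact hB
      · have := hdy s (2 * b') (h ▸ hbn)
        rwa [← h] at this
    rw [sum_finIoc_split g (hmono (show a ≤ 2 * a' by omega))
        (hmono (show 2 * a' ≤ b by omega)),
      sum_finIoc_split g (hmono (show 2 * a' ≤ 2 * b' by omega))
        (hmono (show 2 * b' ≤ b by omega))]
    push_cast
    linarith

theorem sum_Icc_le {k n : ℕ} (hn : n = 2 ^ k) {g : Fin n → ℝ} {B : ℝ} (hB : 0 ≤ B)
    (hg : ∀ I, IsDyadicInterval I → ∑ i ∈ I, g i ≤ B) {a b : Fin n} (hab : a ≤ b) :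
    ∑ i ∈ Finset.Icc a b, g i ≤ (2 * k + 1) * B := by
  -- In lattice coordinates the zero-based `Icc a b` is (a, b + 1].
  have := sum_finIoc_le hB hg k 0 a (b + 1) (by omega) (by omega) (by omega)
  convert this using 2
  ext i
  simp only [Finset.mem_Icc, mem_finIoc, Fin.le_def]
  omega

/-- Slicing along coordinate j turns a sum over a product into a one-dimensional sum, to which the
interval bound applies. -/
theorem sum_piFinset_update {ι α : Type*} [Fintype ι] [DecidableEq ι] [DecidableEq α]
    (I : ι → Finset α) (j : ι) (X : Finset α) (g : (ι → α) → ℝ) :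
    ∑ u ∈ Fintype.piFinset (Function.update I j X), g u
      = ∑ x ∈ X, ∑ u ∈ Fintype.piFinset (Function.update I j {x}), g u := by
  rw [← Finset.sum_biUnion]
  · refine Finset.sum_congr ?_ fun _ _ => rfl
    ext u
    simp only [Fintype.mem_piFinset, Finset.mem_biUnion]
    constructor
    · refine fun h => ⟨u j, by simpa using h j, fun i => ?_⟩
      by_cases hi : i = j
      · subst hi; simp
      · simpa [hi] using h i
    · rintro ⟨x, hx, h⟩ i
      by_cases hi : i = j
      · subst hi
        have := h i
        simp only [Function.update_self, Finset.mem_singleton] at this ⊢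
        rwa [this]
      · simpa [hi] using h i
  · intro x _ x' _ hne
    rw [Function.onFun, Finset.disjoint_left]
    intro u hu hu'
    have h1 := Fintype.mem_piFinset.1 hu j
    have h2 := Fintype.mem_piFinset.1 hu' j
    simp only [Function.update_self, Finset.mem_singleton] at h1 h2
    exact hne (h1.symm.trans h2)

/-- A bound for the sums over dyadic rectangles gives one for the sums over rectangles. -/
theorem sum_rectangle_le {d k n : ℕ} (hn : n = 2 ^ k) {g : Grid d n → ℝ} {B : ℝ} (hB : 0 ≤ B)
    (hg : ∀ D, IsDyadicRectangle D → ∑ u ∈ D, g u ≤ B) {R : Finset (Grid d n)}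
    (hR : IsRectangle R) : ∑ u ∈ R, g u ≤ (2 * k + 1) ^ d * B := by
  -- J collects the coordinates whose sides are arbitrary intervals; the others are already dyadic.
  -- Each element of J costs a factor 2k + 1.
  have main (J : Finset (Fin d)) : ∀ I : Fin d → Finset (Fin n),
      (∀ i ∈ J, ∃ a b, a ≤ b ∧ I i = Finset.Icc a b) → (∀ i ∉ J, IsDyadicInterval (I i)) →
      ∑ u ∈ Fintype.piFinset I, g u ≤ (2 * k + 1) ^ J.card * B := by
    induction J using Finset.induction_on with
    | empty =>
      intro I _ hI
      simpa using hg _ ⟨I, fun i => hI i (Finset.notMem_empty i), rfl⟩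
    | insert j J hj ih =>
      intro I hI hI'
      obtain ⟨a, b, hab, hIj⟩ := hI j (Finset.mem_insert_self j J)
      rw [← Function.update_eq_self j I, sum_piFinset_update, hIj, Finset.card_insert_of_notMem hj,
        pow_succ', mul_assoc]
      refine sum_Icc_le hn (by positivity) (fun X hX => ?_) hab
      rw [← sum_piFinset_update]
      refine ih _ (fun i hi => ?_) fun i hi => ?_
      · rw [Function.update_of_ne (ne_of_mem_of_not_mem hi hj)]
        exact hI i (Finset.mem_insert_of_mem hi)
      · by_cases hij : i = j
        · subst hij
          simpa using hX
        · rw [Function.update_of_ne hij]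
          exact hI' i (by simp [hij, hi])
  obtain ⟨a, b, hab, rfl⟩ := hR
  simpa using main Finset.univ (fun i => Finset.Icc (a i) (b i)) (fun i _ => ⟨a i, b i, hab i, rfl⟩)
    (fun i hi => absurd (Finset.mem_univ i) hi)

open Classical in
-- There are at most 2^(k-s) positions at scale s ≤ k, and the geometric sum is below 2 · 2^k.
theorem card_dyadicInterval_le {k n : ℕ} (hn : n = 2 ^ k) :
    ((Finset.univ : Finset (Finset (Fin n))).filter IsDyadicInterval).card ≤ 2 * n := by
  have hsub : (Finset.univ : Finset (Finset (Fin n))).filter IsDyadicInterval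
      ⊆ ((Finset.range (k + 1)).sigma fun s => Finset.range (2 ^ (k - s))).image fun p =>
        Finset.univ.filter fun i : Fin n =>
          p.2 * 2 ^ p.1 < (i : ℕ) + 1 ∧ (i : ℕ) + 1 ≤ (p.2 + 1) * 2 ^ p.1 := by
    intro I hI
    obtain ⟨s, a, h, rfl⟩ := (Finset.mem_filter.1 hI).2
    have hs : s ≤ k := by
      refine (Nat.pow_le_pow_iff_right one_lt_two).1 ?_
      rw [← hn]
      exact (Nat.le_mul_of_pos_left _ a.succ_pos).trans h
    refine Finset.mem_image.2 ⟨⟨s, a⟩, ?_, rfl⟩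
    simp only [Finset.mem_sigma, Finset.mem_range]
    refine ⟨by omega, Nat.lt_of_succ_le (Nat.le_of_mul_le_mul_right ?_ (Nat.two_pow_pos s))⟩
    rwa [← pow_add, Nat.sub_add_cancel hs, ← hn]
  refine (Finset.card_le_card hsub).trans (Finset.card_image_le.trans ?_)
  rw [Finset.card_sigma]
  simp only [Finset.card_range]
  have := Finset.sum_range_reflect (fun s => 2 ^ s) (k + 1)
  simp only [Nat.add_sub_cancel] at this
  rw [this, Nat.geomSum_eq le_rfl, hn]
  have : 2 ^ (k + 1) = 2 * 2 ^ k := pow_succ' _ _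
  omega

theorem card_dyadicRectangles_le {d k n : ℕ} (hn : n = 2 ^ k) :
    (dyadicRectangles d n).card ≤ (2 * n) ^ d := by
  classical
  have hsub : dyadicRectangles d n ⊆ (Fintype.piFinset fun _ : Fin d =>
      (Finset.univ : Finset (Finset (Fin n))).filter IsDyadicInterval).image
        fun I => Fintype.piFinset I := by
    intro R hR
    obtain ⟨I, hI, rfl⟩ := (Finset.mem_filter.1 hR).2
    exact Finset.mem_image.2 ⟨I, Fintype.mem_piFinset.2 fun i => by simp [hI i], by
      ext; simp⟩
  refine (Finset.card_le_card hsub).trans (Finset.card_image_le.trans ?_)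
  rw [Fintype.card_piFinset, Finset.prod_const, Finset.card_univ, Fintype.card_fin]
  exact Nat.pow_le_pow_left (card_dyadicInterval_le hn) d

end Dyadic

/-! ### The deterministic regret bound for OLRADRE -/

section Regret

variable {d n m : ℕ}

instance : Nonempty (MultiDeg d m) := ⟨⟨0, by simp⟩⟩

theorem abs_feature_le (u : Grid d n) (a : MultiDeg d m) : |feature d n m u a| ≤ 1 := by
  have h (i : Fin d) : 0 ≤ (((u i : ℕ) : ℝ) + 1) / n := by positivity
  have h1 (i : Fin d) : (((u i : ℕ) : ℝ) + 1) / n ≤ 1 := by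
    have : ((u i : ℕ) : ℝ) + 1 ≤ n := by exact_mod_cast (u i).2
    exact div_le_one_of_le₀ this (Nat.cast_nonneg n)
  rw [feature, abs_of_nonneg (Finset.prod_nonneg fun i _ => pow_nonneg (h i) _)]
  exact Finset.prod_le_one (fun i _ => pow_nonneg (h i) _) fun i _ => pow_le_one₀ (h i) (h1 i)

theorem feature_mul_pow_deg (hn : n ≠ 0) (u : Grid d n) (a : MultiDeg d m) :
    feature d n m u a * (n : ℝ) ^ a.deg = monomialAt u a := by
  rw [feature, MultiDeg.deg, ← Finset.prod_pow_eq_pow_sum, ← Finset.prod_mul_distrib, monomialAt]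
  refine Finset.prod_congr rfl fun i _ => ?_
  rw [← mul_pow, div_mul_cancel₀ _ (Nat.cast_ne_zero.2 hn)]

open Matrix in
-- A polynomial with coefficients b is linear in the rescaled features with coefficients n^|𝐦| b.
-- The ridge penalty is the squared norm of the latter, which is why `coeffNorm` enters the bound.
theorem feature_dotProduct (hn : n ≠ 0) (b : MultiDeg d m → ℝ) (u : Grid d n) :
    (feature d n m u ⬝ᵥ fun a => (n : ℝ) ^ a.deg * b a) = ∑ a, b a * monomialAt u a := by
  refine Finset.sum_congr rfl fun a _ => ?_
  rw [← feature_mul_pow_deg hn]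
  ring

open Matrix in
theorem dotProduct_self_le_coeffNorm {P : Finset (Finset (Grid d n))}
    (β : Finset (Grid d n) → MultiDeg d m → ℝ) {R : Finset (Grid d n)} (hR : R ∈ P) :
    ((fun a : MultiDeg d m => (n : ℝ) ^ a.deg * β R a) ⬝ᵥ fun a => (n : ℝ) ^ a.deg * β R a)
      ≤ Fintype.card (MultiDeg d m) * (coeffNorm P β : ℝ) ^ 2 := by
  rw [← Finset.card_univ, ← nsmul_eq_mul]
  refine Finset.sum_le_card_nsmul _ _ _ fun a _ => ?_
  have h : ‖(n : ℝ) ^ a.deg * β R a‖₊ ≤ coeffNorm P β :=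
    Finset.le_sup (f := fun p : Finset (Grid d n) × MultiDeg d m =>
      ‖(n : ℝ) ^ p.2.deg * β p.1 p.2‖₊) (Finset.mk_mem_product hR (Finset.mem_univ a))
  rw [← sq, ← sq_abs]
  exact pow_le_pow_left₀ (abs_nonneg _) (by exact_mod_cast h) 2

/-- The constant in the regret bound. -/
noncomputable def regretConst (m d : ℕ) : ℝ :=
  3 ^ d * (2 * Fintype.card (MultiDeg d m)
    + Fintype.card (MultiDeg d m) * (2 * Real.log (Fintype.card (MultiDeg d m)) + 1) + 16)

theorem sixteen_le_regretConst (m d : ℕ) : 16 ≤ regretConst m d := by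
  have h1 : (1 : ℝ) ≤ 3 ^ d := one_le_pow₀ (by norm_num)
  have h2 : 0 ≤ Real.log (Fintype.card (MultiDeg d m)) := Real.log_natCast_nonneg _
  have h3 : (0 : ℝ) ≤ 2 * Fintype.card (MultiDeg d m)
      + Fintype.card (MultiDeg d m) * (2 * Real.log (Fintype.card (MultiDeg d m)) + 1) := by
    positivity
  rw [regretConst]
  nlinarith

theorem one_lt_regretConst (m d : ℕ) : 1 < regretConst m d := by
  linarith [sixteen_le_regretConst m d]

/-- Allows terms without a logarithm to be absorbed into the logarithmic ones. -/
theorem one_half_le_log_two_pow_mul (hd : 1 ≤ d) (hn : n ≠ 0) :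
    1 / 2 ≤ Real.log ((2 : ℝ) ^ d * (n : ℝ) ^ d) := by
  have h1 : (1 : ℝ) ≤ (n : ℝ) ^ d := one_le_pow₀ (by exact_mod_cast Nat.one_le_iff_ne_zero.2 hn)
  have h2 : (2 : ℝ) ≤ 2 ^ d := by simpa using pow_le_pow_right₀ (by norm_num : (1 : ℝ) ≤ 2) hd
  have h3 : Real.log 2 ≤ Real.log ((2 : ℝ) ^ d * (n : ℝ) ^ d) :=
    Real.log_le_log (by norm_num) (by nlinarith)
  linarith [Real.log_two_gt_d9]

/-- The right side is 3 + 3k log 2, and 3 log 2 > 2. -/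
theorem two_mul_add_one_le_log {k : ℕ} (hn : n = 2 ^ k) :
    2 * (k : ℝ) + 1 ≤ 3 * Real.log (Real.exp 1 * n) := by
  rw [Real.log_mul (Real.exp_pos 1).ne' (by rw [hn]; positivity), Real.log_exp, hn, Nat.cast_pow,
    Real.log_pow]
  have := mul_le_mul_of_nonneg_left Real.log_two_gt_d9.le (Nat.cast_nonneg (α := ℝ) k)
  push_cast
  linarith [Nat.cast_nonneg (α := ℝ) k]

/-- Aggregation regret plus regret of the expert D. The comparison is with the polynomial of the
piece R, which is defined on the whole lattice, so D need not lie inside R. -/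
theorem sum_sq_sub_olradre_dyadic_le (hn : n ≠ 0) {N : ℕ} (hd : 1 ≤ d) {k : ℕ} (hk : n = 2 ^ k)
    {lam : ℝ} (hlam : 0 < lam)
    (ρ : Fin N ≃ Grid d n) {y : Grid d n → ℝ} (hy : ∀ u, |y u| ≤ lam)
    {P : Finset (Finset (Grid d n))} (β : Finset (Grid d n) → MultiDeg d m → ℝ)
    {R : Finset (Grid d n)} (hR : R ∈ P) {D : Finset (Grid d n)} (hD : IsDyadicRectangle D) :
    ∑ u ∈ D, ((y u - olradre d n m lam ρ y u) ^ 2 - (y u - ∑ a, β R a * monomialAt u a) ^ 2)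
      ≤ (2 * Fintype.card (MultiDeg d m)
        + Fintype.card (MultiDeg d m) * (2 * Real.log (Fintype.card (MultiDeg d m)) + 1) + 16)
        * ((lam + coeffNorm P β) ^ 2 * Real.log ((2 : ℝ) ^ d * (n : ℝ) ^ d)) := by
  have hDmem : D ∈ dyadicRectangles d n := by
    classical
    rw [dyadicRectangles, Finset.mem_filter]
    exact ⟨Finset.mem_univ _, hD⟩
  have h1 := sum_sq_sub_aggregate_le (r := vawRule (feature d n m)) (ρ := ρ) hlam hy hDmem
  have h2 := sum_sq_sub_expertPred_vawRule_le (x := feature d n m) abs_feature_le hy ρ D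
    fun a => (n : ℝ) ^ a.deg * β R a
  simp only [feature_dotProduct hn] at h2
  have h3 := dotProduct_self_le_coeffNorm β hR
  set p : ℝ := ((Fintype.card (MultiDeg d m) : ℕ) : ℝ) with hp
  set s : ℝ := (coeffNorm P β : ℝ) with hs
  set L := Real.log ((2 : ℝ) ^ d * (n : ℝ) ^ d) with hL
  have hs0 : 0 ≤ s := NNReal.coe_nonneg _
  have hL2 : 1 / 2 ≤ L := one_half_le_log_two_pow_mul hd hn
  have hp1 : 1 ≤ p := by
    rw [hp]
    exact_mod_cast Fintype.card_pos
  have hn1 : (1 : ℝ) ≤ (n : ℝ) ^ d := one_le_pow₀ (by exact_mod_cast Nat.one_le_iff_ne_zero.2 hn)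
  have hlogE : Real.log (dyadicRectangles d n).card ≤ L := by
    refine Real.log_le_log (by exact_mod_cast Finset.card_pos.2 ⟨D, hDmem⟩) ?_
    rw [← mul_pow]
    exact_mod_cast card_dyadicRectangles_le hk
  have hlogD : Real.log (p * (1 + D.card)) ≤ (2 * Real.log p + 1) * L := by
    have hc : (D.card : ℝ) ≤ (n : ℝ) ^ d := by
      have := Finset.card_le_univ D
      simp only [Fintype.card_pi, Fintype.card_fin, Finset.prod_const, Finset.card_univ] at this
      exact_mod_cast this
    rw [Real.log_mul (by positivity) (by positivity)]
    have h5 : Real.log (1 + D.card) ≤ L := by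
      refine Real.log_le_log (by positivity) ?_
      have : (2 : ℝ) ≤ 2 ^ d := by simpa using pow_le_pow_right₀ (by norm_num : (1 : ℝ) ≤ 2) hd
      nlinarith
    nlinarith [Real.log_nonneg hp1]
  have hlogp := Real.log_nonneg hp1
  -- The ridge penalty gives 2p and the log-determinant p(2 log p + 1). The prior 8 log|E| and the
  -- sleeping round 4 ≤ 8L together give 16.
  have e1 : p * s ^ 2 ≤ 2 * p * ((lam + s) ^ 2 * L) := by
    have : s ^ 2 ≤ (lam + s) ^ 2 := pow_le_pow_left₀ hs0 (by linarith) 2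
    have h6 : s ^ 2 ≤ 2 * ((lam + s) ^ 2 * L) := by nlinarith [sq_nonneg (lam + s)]
    nlinarith
  have hlam2 : lam ^ 2 ≤ (lam + s) ^ 2 := pow_le_pow_left₀ hlam.le (by linarith) 2
  have hlamL : lam ^ 2 * L ≤ (lam + s) ^ 2 * L := mul_le_mul_of_nonneg_right hlam2 (by linarith)
  have e2 : lam ^ 2 * (p * Real.log (p * (1 + D.card)))
      ≤ p * (2 * Real.log p + 1) * ((lam + s) ^ 2 * L) :=
    calc lam ^ 2 * (p * Real.log (p * (1 + D.card)))
        ≤ lam ^ 2 * (p * ((2 * Real.log p + 1) * L)) := by gcongr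
      _ = p * (2 * Real.log p + 1) * (lam ^ 2 * L) := by ring
      _ ≤ p * (2 * Real.log p + 1) * ((lam + s) ^ 2 * L) := by gcongr
  have e3 : 8 * lam ^ 2 * Real.log (dyadicRectangles d n).card ≤ 8 * ((lam + s) ^ 2 * L) := by
    nlinarith [mul_le_mul_of_nonneg_left hlogE (sq_nonneg lam)]
  have e4 : 4 * lam ^ 2 ≤ 8 * ((lam + s) ^ 2 * L) := by nlinarith [sq_nonneg lam]
  rw [Finset.sum_sub_distrib]
  simp only [olradre]
  linarith

theorem sum_sq_sub_olradre_sub_le {N : ℕ} (hd : 1 ≤ d) {k : ℕ} (hk : n = 2 ^ k)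
    {lam : ℝ} (hlam : 0 < lam) (ρ : Fin N ≃ Grid d n) {y : Grid d n → ℝ} (hy : ∀ u, |y u| ≤ lam)
    {T : Finset (Grid d n)} (P : Finpartition T) (hP : ∀ R ∈ P.parts, IsRectangle R)
    {θ : Grid d n → ℝ} {β : Finset (Grid d n) → MultiDeg d m → ℝ}
    (hθ : IsPiecewisePoly P.parts β θ) :
    ∑ u ∈ T, (y u - olradre d n m lam ρ y u) ^ 2 - ∑ u ∈ T, (y u - θ u) ^ 2
      ≤ regretConst m d * (lam + coeffNorm P.parts β) ^ 2 * P.parts.card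
        * Real.log (Real.exp 1 * n) ^ d * Real.log ((2 : ℝ) ^ d * (n : ℝ) ^ d) := by
  have hn : n ≠ 0 := by rw [hk]; positivity
  set p : ℝ := ((Fintype.card (MultiDeg d m) : ℕ) : ℝ) with hp
  set B := (2 * p + p * (2 * Real.log p + 1) + 16)
        * ((lam + coeffNorm P.parts β) ^ 2 * Real.log ((2 : ℝ) ^ d * (n : ℝ) ^ d)) with hB
  have hB0 : 0 ≤ B := by
    have h1 := one_half_le_log_two_pow_mul hd hn
    have h2 : 0 ≤ Real.log p := Real.log_natCast_nonneg _
    have h3 : 0 ≤ Real.log ((2 : ℝ) ^ d * (n : ℝ) ^ d) := by linarith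
    positivity
  have hpart : ∀ R ∈ P.parts,
      ∑ u ∈ R, ((y u - olradre d n m lam ρ y u) ^ 2 - (y u - θ u) ^ 2)
        ≤ (3 * Real.log (Real.exp 1 * n)) ^ d * B := by
    intro R hR
    rw [Finset.sum_congr rfl fun u hu => by rw [hθ R hR u hu]]
    refine (sum_rectangle_le hk hB0 (fun D hD =>
      sum_sq_sub_olradre_dyadic_le hn hd hk hlam ρ hy β hR hD) (hP R hR)).trans ?_
    exact mul_le_mul_of_nonneg_right
      (pow_le_pow_left₀ (by positivity) (two_mul_add_one_le_log hk) d) hB0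
  rw [← Finset.sum_sub_distrib]
  have hT : ∑ u ∈ T, ((y u - olradre d n m lam ρ y u) ^ 2 - (y u - θ u) ^ 2)
      = ∑ R ∈ P.parts, ∑ u ∈ R, ((y u - olradre d n m lam ρ y u) ^ 2 - (y u - θ u) ^ 2) := by
    conv_lhs => rw [← P.biUnion_parts]
    exact Finset.sum_biUnion P.disjoint
  rw [hT]
  refine (Finset.sum_le_card_nsmul _ _ _ hpart).trans (le_of_eq ?_)
  rw [nsmul_eq_mul, mul_pow, hB, regretConst, ← hp]
  ring

end Regret

/-! ### Measurability of the aggregate -/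

section Measurability

variable {K : Type} [DecidableEq K] [Fintype K] {N : ℕ}
  {r : OnlineRule K} {E : Finset (Finset K)} {lam : ℝ}

theorem measurable_trunc (a : ℝ) : Measurable (trunc a) :=
  (measurable_id.max measurable_const).min measurable_const

theorem measurable_expertPred (hr : ∀ S U s, Measurable (r S U s)) (ρ : Fin N ≃ K) (S : Finset K)
    (t : Fin N) : Measurable fun y => expertPred r ρ y S t :=
  (hr _ _ _).comp (measurable_pi_lambda _ fun _ => measurable_pi_apply _)

theorem measurable_loss (hr : ∀ S U s, Measurable (r S U s)) (ρ : Fin N ≃ K) (S : Finset K)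
    (t : Fin N) : Measurable fun y => loss r lam ρ y S t :=
  (((measurable_trunc lam).comp (measurable_pi_apply _)).sub
    ((measurable_trunc lam).comp (measurable_expertPred hr ρ S t))).pow_const 2

theorem measurable_weight (hr : ∀ S U s, Measurable (r S U s)) (ρ : Fin N ≃ K) (t : ℕ)
    (S : Finset K) : Measurable fun y => weight r E lam ρ y t S := by
  induction t generalizing S with
  | zero => simp only [weight, measurable_const]
  | succ t ih =>
    simp only [weight]
    split_ifs with h hS
    · have hexp (S' : Finset K) : Measurable fun y => weight r E lam ρ y t S' *
          Real.exp (-(1 / (8 * lam ^ 2)) * loss r lam ρ y S' ⟨t, h⟩) :=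
        (ih S').mul ((measurable_loss hr ρ S' _).const_mul _).exp
      exact ((hexp S).div (Finset.measurable_sum _ fun S' _ => hexp S')).mul
        (Finset.measurable_sum _ fun S' _ => ih S')
    · exact ih S
    · exact ih S

theorem measurable_aggregate (hr : ∀ S U s, Measurable (r S U s)) (ρ : Fin N ≃ K) (s : K) :
    Measurable fun y => aggregate r E lam ρ y s :=
  Finset.measurable_sum _ fun S _ => ((measurable_weight hr ρ _ S).div
    (Finset.measurable_sum _ fun S' _ => measurable_weight hr ρ _ S')).mul
      ((measurable_trunc lam).comp (measurable_expertPred hr ρ S _))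

theorem symm_eq_of_agree {ρ ρ' : Fin N ≃ K} {t : Fin N} (h : ∀ j ≤ t, ρ j = ρ' j) {u : K}
    (hu : ρ.symm u ≤ t) : ρ'.symm u = ρ.symm u := by
  rw [Equiv.symm_apply_eq, ← h _ hu, Equiv.apply_symm_apply]

theorem revealed_congr {ρ ρ' : Fin N ≃ K} {t : Fin N} (h : ∀ j ≤ t, ρ j = ρ' j) :
    revealed ρ t = revealed ρ' t := by
  ext u
  simp only [revealed, Finset.mem_filter, Finset.mem_univ, true_and]
  constructor
  · intro hu
    rwa [symm_eq_of_agree h hu.le]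
  · intro hu
    rwa [symm_eq_of_agree (fun j hj => (h j hj).symm) hu.le]

theorem expertPred_congr {ρ ρ' : Fin N ≃ K} {y y' : K → ℝ} {t : Fin N}
    (h : ∀ j ≤ t, ρ j = ρ' j) (hy : ∀ j < t, y (ρ j) = y' (ρ j)) (S : Finset K) :
    expertPred r ρ y S t = expertPred r ρ' y' S t := by
  have hyU : (fun u : ↥(revealed ρ t ∩ S) => y u) = fun u : ↥(revealed ρ t ∩ S) => y' u := by
    funext u
    have hu := (Finset.mem_filter.1 (Finset.mem_inter.1 u.2).1).2
    simpa using hy _ hu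
  rw [expertPred, expertPred, hyU, h t le_rfl, revealed_congr h]

theorem active_congr {ρ ρ' : Fin N ≃ K} {t : Fin N} (h : ∀ j ≤ t, ρ j = ρ' j) :
    active E ρ t = active E ρ' t := by
  refine Finset.filter_congr fun S _ => ?_
  rw [h t le_rfl]
  refine and_congr_right fun _ => or_congr_right (exists_congr fun j => and_congr_right fun hj => ?_)
  rw [h j hj.le]

theorem loss_congr {ρ ρ' : Fin N ≃ K} {y y' : K → ℝ} {t : Fin N}
    (h : ∀ j ≤ t, ρ j = ρ' j) (hy : ∀ j ≤ t, y (ρ j) = y' (ρ j)) (S : Finset K) :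
    loss r lam ρ y S t = loss r lam ρ' y' S t := by
  rw [loss, loss, expertPred_congr h (fun j hj => hy j hj.le), hy t le_rfl, h t le_rfl]

theorem weight_congr {ρ ρ' : Fin N ≃ K} {y y' : K → ℝ} {t : Fin N}
    (h : ∀ j ≤ t, ρ j = ρ' j) (hy : ∀ j < t, y (ρ j) = y' (ρ j)) (i : ℕ) (hi : i ≤ t)
    (S : Finset K) : weight r E lam ρ y i S = weight r E lam ρ' y' i S := by
  induction i generalizing S with
  | zero => simp only [weight]
  | succ i ih =>
    have hiN : i < N := by omega
    have hlt : (⟨i, hiN⟩ : Fin N) < t := Fin.lt_def.2 hi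
    have hl (S' : Finset K) :=
      loss_congr (r := r) (lam := lam) (fun j (hj : j ≤ ⟨i, hiN⟩) => h j (hj.trans hlt.le))
        (fun j hj => hy j (hj.trans_lt hlt)) S'
    simp only [weight, dif_pos hiN, hl, ih (by omega),
      active_congr (E := E) fun j (hj : j ≤ ⟨i, hiN⟩) => h j (hj.trans hlt.le)]

/-- The prediction at round `t` only depends on the points revealed up to round `t` and the data
revealed before round `t`. -/
theorem aggregate_congr {ρ ρ' : Fin N ≃ K} {y y' : K → ℝ} {t : Fin N}
    (h : ∀ j ≤ t, ρ j = ρ' j) (hy : ∀ j < t, y (ρ j) = y' (ρ j)) :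
    aggregate r E lam ρ y (ρ t) = aggregate r E lam ρ' y' (ρ' t) := by
  simp only [aggregate, Equiv.symm_apply_apply, active_congr (E := E) h,
    weight_congr (r := r) (E := E) (lam := lam) h hy t le_rfl,
    expertPred_congr (r := r) h hy]

variable {Ω : Type*}

/-- There are finitely many orderings, and on the event that ρ agrees with a fixed one up to round t
the prediction is a measurable function of earlier data. The σ-algebra is left arbitrary so that it
can be the past as well as the ambient one. -/
theorem measurable_aggregate_round [MeasurableSpace Ω] (hr : ∀ S U s, Measurable (r S U s))
    {ρ : Ω → Fin N ≃ K} {y : K → Ω → ℝ} {t : Fin N}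
    (hρ : ∀ j ≤ t, ∀ s, MeasurableSet {ω | ρ ω j = s})
    (hy : ∀ j < t, Measurable fun ω => y (ρ ω j) ω) :
    Measurable fun ω => aggregate r E lam (ρ ω) (fun u => y u ω) (ρ ω t) := by
  -- Unrevealed data are replaced by 0; the value is immaterial, since the prediction does not see
  -- them.
  let y' (e : Fin N ≃ K) (ω : Ω) (u : K) : ℝ :=
    if e.symm u < t then y (ρ ω (e.symm u)) ω else 0
  have hy' (e : Fin N ≃ K) : Measurable (y' e) := by
    refine measurable_pi_lambda _ fun u => ?_
    by_cases h : e.symm u < t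
    · simpa only [y', if_pos h] using hy _ h
    · simp only [y', if_neg h, measurable_const]
  have hset (e : Fin N ≃ K) : MeasurableSet {ω | ∀ j ≤ t, ρ ω j = e j} := by
    have : {ω | ∀ j ≤ t, ρ ω j = e j} = ⋂ j, ⋂ _ : j ≤ t, {ω | ρ ω j = e j} := by
      ext; simp
    rw [this]
    exact MeasurableSet.iInter fun j => MeasurableSet.iInter fun hj => hρ j hj _
  have hagree (e : Fin N ≃ K) (ω : Ω) (h : ∀ j ≤ t, ρ ω j = e j) :
      aggregate r E lam (ρ ω) (fun u => y u ω) (ρ ω t) = aggregate r E lam e (y' e ω) (e t) := by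
    refine aggregate_congr h fun j hj => ?_
    simp only [y', h j hj.le, Equiv.symm_apply_apply, if_pos hj]
  intro B hB
  have : (fun ω => aggregate r E lam (ρ ω) (fun u => y u ω) (ρ ω t)) ⁻¹' B
      = ⋃ e : Fin N ≃ K, {ω | ∀ j ≤ t, ρ ω j = e j}
        ∩ (fun ω => aggregate r E lam e (y' e ω) (e t)) ⁻¹' B := by
    ext ω
    simp only [Set.mem_preimage, Set.mem_iUnion, Set.mem_inter_iff, Set.mem_ofPred_eq]
    constructor
    · exact fun h => ⟨ρ ω, fun _ _ => rfl, hagree (ρ ω) ω (fun _ _ => rfl) ▸ h⟩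
    · rintro ⟨e, he, h⟩
      rwa [hagree e ω he]
  rw [this]
  exact MeasurableSet.iUnion fun e =>
    (hset e).inter (((measurable_aggregate hr e (e t)).comp (hy' e)) hB)

theorem measurable_vawRule {ι : Type} [Fintype ι] [DecidableEq ι] (x : K → ι → ℝ)
    (S U : Finset K) (s : K) : Measurable (vawRule x S U s) := by
  unfold vawRule
  refine Continuous.measurable ?_
  fun_prop

end Measurability

/-! ### Non-anticipating orderings -/

section NonAnticipating

variable {K : Type} [DecidableEq K] [Fintype K] {N : ℕ} {Ω : Type*} [mΩ : MeasurableSpace Ω]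
  {μ : Measure Ω} {ε y : K → Ω → ℝ} {ρ : Ω → Fin N ≃ K}

theorem measurable_apply_of_finite (hy : ∀ s, Measurable (y s)) {f : Ω → K}
    (hf : ∀ s, MeasurableSet {ω | f ω = s}) : Measurable fun ω => y (f ω) ω := by
  have : (fun ω => y (f ω) ω) = fun ω => ∑ s, {ω | f ω = s}.indicator (y s) ω := by
    funext ω
    rw [Finset.sum_eq_single (f ω)]
    · simp
    · intro s _ hs
      exact Set.indicator_of_notMem (fun h => hs h.symm) _
    · simp
  rw [this]
  exact Finset.measurable_sum _ fun s _ => (hy s).indicator (hf s)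

theorem pastSigma_le (hy : ∀ s, Measurable (y s)) (hρ : ∀ t s, MeasurableSet {ω | ρ ω t = s})
    (t : Fin N) : pastSigma y ρ t ≤ mΩ := by
  refine sup_le (iSup₂_le fun j _ => ?_) (iSup₂_le fun j _ => ?_)
  · rintro _ ⟨B, -, rfl⟩
    have : (fun ω => ρ ω j) ⁻¹' B = ⋃ s ∈ B, {ω | ρ ω j = s} := by ext; simp
    rw [this]
    exact MeasurableSet.biUnion (Set.to_countable B) fun s _ => hρ j s
  · exact (measurable_apply_of_finite hy (hρ j)).comap_le

theorem measurableSet_pastSigma {t j : Fin N} (hj : j ≤ t) (s : K) :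
    MeasurableSet[pastSigma y ρ t] {ω | ρ ω j = s} :=
  (le_iSup₂_of_le (f := fun (j : Fin N) (_ : j ≤ t) =>
    MeasurableSpace.comap (fun ω => ρ ω j) ⊤) j hj le_rfl).trans le_sup_left _ ⟨{s}, trivial, rfl⟩

theorem measurable_pastSigma {t j : Fin N} (hj : j < t) :
    Measurable[pastSigma y ρ t] fun ω => y (ρ ω j) ω :=
  measurable_iff_comap_le.2 <| (le_iSup₂_of_le (f := fun (j : Fin N) (_ : j < t) =>
    MeasurableSpace.comap (fun ω => y (ρ ω j) ω) (inferInstance : MeasurableSpace ℝ)) j hj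
      le_rfl).trans le_sup_right

/-- A bounded function of the past is uncorrelated with the noise at the current point. -/
theorem setIntegral_past_mul_noise_eq [IsProbabilityMeasure μ] (hε : ∀ s, Measurable (ε s))
    (hy : ∀ s, Measurable (y s)) (hρ : IsNonAnticipating μ ε y ρ) (t : Fin N) (s : K) {g : Ω → ℝ}
    (hg : Measurable[pastSigma y ρ t] g) :
    ∫ ω in {ω | ρ ω t = s}, g ω * ε s ω ∂μ
      = (∫ ω in {ω | ρ ω t = s}, g ω ∂μ) * ∫ ω, ε s ω ∂μ := by
  have hle := pastSigma_le hy hρ.measurable t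
  have hg' : Measurable g := hg.mono hle le_rfl
  set A := {ω | ρ ω t = s} with hA
  have hAm : MeasurableSet[pastSigma y ρ t] A := measurableSet_pastSigma le_rfl s
  -- On A the current noise is ε s and its conditional law is constant. Integrating the conditional
  -- probability over a past event inside A therefore factorizes.
  have hrect (B₁ B₂ : Set ℝ) (h1 : MeasurableSet B₁) (h2 : MeasurableSet B₂) :
      μ (g ⁻¹' B₁ ∩ A ∩ ε s ⁻¹' B₂) = μ (g ⁻¹' B₁ ∩ A) * μ (ε s ⁻¹' B₂) := by
    have hG : MeasurableSet[pastSigma y ρ t] (g ⁻¹' B₁ ∩ A) :=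
      MeasurableSet.inter (hg h1) hAm
    have hXt : MeasurableSet {ω | ε (ρ ω t) ω ∈ B₂} :=
      measurable_apply_of_finite hε (hρ.measurable t) h2
    have hc := hρ.cond_law t s B₂ h2
    have e1 : ∫ ω in g ⁻¹' B₁ ∩ A, (μ⟦{ω' | ε (ρ ω' t) ω' ∈ B₂} | pastSigma y ρ t⟧) ω ∂μ
        = μ.real (g ⁻¹' B₁ ∩ A) * μ.real (ε s ⁻¹' B₂) := by
      rw [setIntegral_congr_ae (g := fun _ => μ.real {ω' | ε s ω' ∈ B₂}) (hle _ hG)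
        (hc.mono fun ω hω hmem => hω hmem.2), setIntegral_const, smul_eq_mul]
      rfl
    have e2 : ∫ ω in g ⁻¹' B₁ ∩ A, (μ⟦{ω' | ε (ρ ω' t) ω' ∈ B₂} | pastSigma y ρ t⟧) ω ∂μ
        = μ.real (g ⁻¹' B₁ ∩ A ∩ ε s ⁻¹' B₂) := by
      rw [setIntegral_condExp hle ((integrable_const (1 : ℝ)).indicator hXt) hG,
        setIntegral_indicator hXt, setIntegral_const, smul_eq_mul, mul_one]
      congr 1
      ext ω
      simp only [Set.mem_inter_iff, Set.mem_preimage, Set.mem_ofPred_eq, hA]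
      refine and_congr_right fun h => ?_
      rw [h.2]
    have e3 := e2.symm.trans e1
    rw [measureReal_def, measureReal_def, measureReal_def, ← ENNReal.toReal_mul] at e3
    exact (ENNReal.toReal_eq_toReal_iff' (measure_ne_top _ _)
      (ENNReal.mul_ne_top (measure_ne_top _ _) (measure_ne_top _ _))).1 e3
  -- Factorization on measurable rectangles identifies the joint law under μ restricted to A as a
  -- product, so the integral of the product splits.
  have hprod : ((μ.restrict A).map g).prod (μ.map (ε s))
      = (μ.restrict A).map fun ω => (g ω, ε s ω) := by
    have : IsProbabilityMeasure (μ.map (ε s)) :=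
      Measure.isProbabilityMeasure_map (hε s).aemeasurable
    refine Measure.prod_eq fun B₁ B₂ h1 h2 => ?_
    rw [Measure.map_apply (hg'.prodMk (hε s)) (h1.prod h2), Measure.map_apply hg' h1,
      Measure.map_apply (hε s) h2, Measure.restrict_apply (hg' h1),
      Measure.restrict_apply ((hg'.prodMk (hε s)) (h1.prod h2)), ← hrect B₁ B₂ h1 h2]
    congr 1
    ext ω
    simp only [Set.mem_inter_iff, Set.mem_preimage, Set.mem_prod]
    tauto
  have hint : ∫ ω in A, g ω * ε s ω ∂μ
      = ∫ p, p.1 * p.2 ∂((μ.restrict A).map fun ω => (g ω, ε s ω)) :=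
    (integral_map (hg'.prodMk (hε s)).aemeasurable
      (measurable_fst.mul measurable_snd).aestronglyMeasurable).symm
  rw [hint, ← hprod, integral_prod_mul (f := fun x : ℝ => x) (g := fun x : ℝ => x),
    integral_map (f := fun x : ℝ => x) hg'.aemeasurable measurable_id.aestronglyMeasurable,
    integral_map (f := fun x : ℝ => x) (hε s).aemeasurable measurable_id.aestronglyMeasurable]

variable {r : OnlineRule K} {E : Finset (Finset K)} {lam : ℝ}

/-- The point s is revealed at a random round. Splitting by that round yields terms each measurable
with respect to a single past. -/
theorem aggregate_eq_sum_indicator (ρ : Ω → Fin N ≃ K) (y : K → Ω → ℝ) (s : K) (ω : Ω) :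
    aggregate r E lam (ρ ω) (fun u => y u ω) s
      = ∑ t : Fin N, {ω | ρ ω t = s}.indicator
          (fun ω => aggregate r E lam (ρ ω) (fun u => y u ω) (ρ ω t)) ω := by
  rw [Finset.sum_eq_single ((ρ ω).symm s)]
  · rw [Set.indicator_of_mem (by simp)]
    simp
  · intro t _ ht
    refine Set.indicator_of_notMem (fun h => ht ?_) _
    rw [← show ρ ω t = s from h, Equiv.symm_apply_apply]
  · simp

theorem measurable_aggregate_random (hr : ∀ S U s, Measurable (r S U s))
    (hy : ∀ s, Measurable (y s)) (hρ : ∀ t s, MeasurableSet {ω | ρ ω t = s}) (s : K) :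
    Measurable fun ω => aggregate r E lam (ρ ω) (fun u => y u ω) s := by
  simp only [aggregate_eq_sum_indicator ρ y s]
  exact Finset.measurable_sum _ fun t _ => (measurable_aggregate_round hr (fun j _ => hρ j)
    fun j _ => measurable_apply_of_finite hy (hρ j)).indicator (hρ t s)

/-- The predictions are uncorrelated with the noise. -/
theorem integral_aggregate_mul_noise_eq_zero [IsProbabilityMeasure μ]
    (hr : ∀ S U s, Measurable (r S U s)) (hlam : 0 ≤ lam) (hε : ∀ s, Measurable (ε s))
    (hy : ∀ s, Measurable (y s)) (hρ : IsNonAnticipating μ ε y ρ) {s : K}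
    (hint : Integrable (ε s) μ) (h0 : ∫ ω, ε s ω ∂μ = 0) :
    ∫ ω, aggregate r E lam (ρ ω) (fun u => y u ω) s * ε s ω ∂μ = 0 := by
  simp only [aggregate_eq_sum_indicator ρ y s, Finset.sum_mul]
  have heq (t : Fin N) : (fun ω => {ω | ρ ω t = s}.indicator
      (fun ω => aggregate r E lam (ρ ω) (fun u => y u ω) (ρ ω t)) ω * ε s ω)
      = {ω | ρ ω t = s}.indicator
        fun ω => aggregate r E lam (ρ ω) (fun u => y u ω) (ρ ω t) * ε s ω := by
    funext ω
    exact (Set.indicator_mul_left _ _ _).symm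
  have hmeas (t : Fin N) : Measurable[pastSigma y ρ t] fun ω =>
      aggregate r E lam (ρ ω) (fun u => y u ω) (ρ ω t) :=
    -- The online character of the predictor enters here: the measurability is with respect to the
    -- past.
    @measurable_aggregate_round K _ _ N r E lam Ω (pastSigma y ρ t) hr ρ y t
      (fun j hj s => measurableSet_pastSigma hj s) fun j hj => measurable_pastSigma hj
  have hmeas' (t : Fin N) : Measurable fun ω =>
      aggregate r E lam (ρ ω) (fun u => y u ω) (ρ ω t) :=
    (hmeas t).mono (pastSigma_le hy hρ.measurable t) le_rfl
  rw [integral_finsetSum]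
  · refine Finset.sum_eq_zero fun t _ => ?_
    rw [heq, integral_indicator (hρ.measurable t s),
      setIntegral_past_mul_noise_eq hε hy hρ t s (hmeas t), h0, mul_zero]
  · intro t _
    rw [heq]
    refine Integrable.indicator ?_ (hρ.measurable t s)
    exact hint.bdd_mul (c := lam) (hmeas' t).aestronglyMeasurable
      (Filter.Eventually.of_forall fun ω => abs_aggregate_le hlam _)

end NonAnticipating

/-! ### Moments and tails of the noise -/

section Noise

variable {K : Type} {Ω : Type*} [MeasurableSpace Ω] {μ : Measure Ω} [IsProbabilityMeasure μ]
  {ε : K → Ω → ℝ}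

theorem measureReal_le_abs_noise_le (hε : IsSubGaussianNoise μ ε) (s : K) {x : ℝ} (hx : 0 ≤ x) :
    μ.real {ω | x ≤ |ε s ω|} ≤ 4 * Real.exp (-x ^ 2 / 2) := by
  have hsub : {ω | x ≤ |ε s ω|} ⊆ {ω | x ≤ ε s ω} ∪ {ω | ε s ω ≤ -x} := by
    intro ω hω
    rcases le_abs.1 (show x ≤ |ε s ω| from hω) with h | h
    · exact Or.inl h
    · exact Or.inr (show ε s ω ≤ -x by linarith)
  linarith [(measureReal_mono (μ := μ) hsub).trans (measureReal_union_le _ _),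
    hε.tail_right s x hx, hε.tail_left s x hx]

/-- Layer cake: 4 ∫ t³ · 4e^{-t²/2} dt = 4 · 8. -/
theorem lintegral_noise_pow_four_le (hε : IsSubGaussianNoise μ ε) (s : K) :
    ∫⁻ ω, ENNReal.ofReal (ε s ω ^ 4) ∂μ ≤ ENNReal.ofReal 32 := by
  have hint : IntegrableOn (fun x : ℝ => 4 * (x ^ (3 : ℝ) * Real.exp (-(1 / 2) * x ^ (2 : ℝ))))
      (Set.Ioi 0) :=
    (integrableOn_rpow_mul_exp_neg_mul_rpow (by norm_num) (by norm_num) (by norm_num)).const_mul 4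
  have hval : ∫ x in Set.Ioi (0 : ℝ), 4 * (x ^ (3 : ℝ) * Real.exp (-(1 / 2) * x ^ (2 : ℝ))) = 8 := by
    rw [integral_const_mul, integral_rpow_mul_exp_neg_mul_rpow (by norm_num) (by norm_num)
      (by norm_num), show ((3 : ℝ) + 1) / 2 = ((1 : ℕ) : ℝ) + 1 by norm_num,
      Real.Gamma_nat_eq_factorial, show -((3 : ℝ) + 1) / 2 = -((2 : ℕ) : ℝ) by norm_num,
      Real.rpow_neg (by norm_num), Real.rpow_natCast]
    norm_num
  have hcake := lintegral_rpow_eq_lintegral_meas_le_mul (μ := μ) (f := fun ω => |ε s ω|) (p := 4)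
    (Filter.Eventually.of_forall fun ω => abs_nonneg _)
    (hε.measurable s).abs.aemeasurable (by norm_num)
  have hpow (ω : Ω) : |ε s ω| ^ (4 : ℝ) = ε s ω ^ 4 := by
    rw [show (4 : ℝ) = ((4 : ℕ) : ℝ) by norm_num, Real.rpow_natCast, Even.pow_abs (by decide)]
  simp only [hpow] at hcake
  have hle : ∫⁻ t in Set.Ioi (0 : ℝ), μ {ω | t ≤ |ε s ω|} * ENNReal.ofReal (t ^ ((4 : ℝ) - 1))
      ≤ ENNReal.ofReal 8 := by
    rw [← hval, ofReal_integral_eq_lintegral_ofReal hint]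
    · refine setLIntegral_mono' measurableSet_Ioi fun t ht => ?_
      have ht0 : (0 : ℝ) ≤ t := le_of_lt ht
      have h1 := measureReal_le_abs_noise_le hε s ht0
      rw [← ofReal_measureReal, ← ENNReal.ofReal_mul measureReal_nonneg]
      refine ENNReal.ofReal_le_ofReal ?_
      have e1 : -(1 / 2) * t ^ (2 : ℝ) = -t ^ 2 / 2 := by
        rw [show (2 : ℝ) = ((2 : ℕ) : ℝ) by norm_num, Real.rpow_natCast]
        ring
      rw [e1, show (4 : ℝ) - 1 = 3 by norm_num]
      calc μ.real {ω | t ≤ |ε s ω|} * t ^ (3 : ℝ)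
          ≤ 4 * Real.exp (-t ^ 2 / 2) * t ^ (3 : ℝ) :=
            mul_le_mul_of_nonneg_right h1 (Real.rpow_nonneg ht0 _)
        _ = _ := by ring
    · refine (ae_restrict_iff' measurableSet_Ioi).2 (Filter.Eventually.of_forall fun t ht => ?_)
      have ht0 : (0 : ℝ) ≤ t := le_of_lt ht
      have := Real.rpow_nonneg ht0 3
      simp only [Pi.zero_apply]
      positivity
  rw [hcake]
  calc _ ≤ ENNReal.ofReal 4 * ENNReal.ofReal 8 := by gcongr
    _ = ENNReal.ofReal 32 := by
      rw [← ENNReal.ofReal_mul (by norm_num)]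
      norm_num

theorem integrable_noise_pow_four (hε : IsSubGaussianNoise μ ε) (s : K) :
    Integrable (fun ω => ε s ω ^ 4) μ := by
  refine ⟨((hε.measurable s).pow_const 4).aestronglyMeasurable, ?_⟩
  rw [hasFiniteIntegral_iff_ofReal (Filter.Eventually.of_forall fun ω => by
    simp only [Pi.zero_apply]; positivity)]
  exact (lintegral_noise_pow_four_le hε s).trans_lt ENNReal.ofReal_lt_top

theorem integral_noise_pow_four_le (hε : IsSubGaussianNoise μ ε) (s : K) :
    ∫ ω, ε s ω ^ 4 ∂μ ≤ 32 := by
  rw [integral_eq_lintegral_of_nonneg_ae (Filter.Eventually.of_forall fun ω => by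
    simp only [Pi.zero_apply]; positivity) (integrable_noise_pow_four hε s).1]
  exact ENNReal.toReal_le_of_le_ofReal (by norm_num) (lintegral_noise_pow_four_le hε s)

theorem integrable_noise (hε : IsSubGaussianNoise μ ε) (s : K) : Integrable (ε s) μ := by
  refine ((integrable_const (1 : ℝ)).add (integrable_noise_pow_four hε s)).mono'
    (hε.measurable s).aestronglyMeasurable (Filter.Eventually.of_forall fun ω => ?_)
  rw [Real.norm_eq_abs, abs_le]
  simp only [Pi.add_apply]
  constructor <;> nlinarith [sq_nonneg (ε s ω ^ 2 - 1 / 2), sq_nonneg (ε s ω - 1 / 2),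
    sq_nonneg (ε s ω + 1 / 2)]

/-- Up to a small probability, the data are bounded by the truncation level. -/
theorem measureReal_exists_lt_abs_le [Fintype K] (hε : IsSubGaussianNoise μ ε) {θs : K → ℝ}
    {σ lam : ℝ} (hσ : 0 < σ) (hK : 1 ≤ Fintype.card K)
    (hlam : 7 * max (σ * √(Real.log (Fintype.card K))) ‖θs‖ ≤ lam) :
    μ.real {ω | ∃ u, lam < |θs u + σ * ε u ω|} ≤ 4 / (Fintype.card K : ℝ) ^ 17 := by
  set M : ℝ := ((Fintype.card K : ℕ) : ℝ) with hM
  have hM1 : 1 ≤ M := by rw [hM]; exact_mod_cast hK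
  have hlog : 0 ≤ Real.log M := Real.log_nonneg hM1
  -- Of the factor 7, one unit covers the signal and six the noise. Six standard units give e^{-18
  -- log M} = M^{-18}, and the union over M points costs one power.
  have hsub : {ω | ∃ u, lam < |θs u + σ * ε u ω|} ⊆ ⋃ u, {ω | 6 * √(Real.log M) ≤ |ε u ω|} := by
    rintro ω ⟨u, hu⟩
    refine Set.mem_iUnion.2 ⟨u, ?_⟩
    have h1 : |θs u + σ * ε u ω| ≤ ‖θs‖ + σ * |ε u ω| := by
      refine (abs_add_le _ _).trans ?_
      rw [abs_mul, abs_of_pos hσ]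
      gcongr
      exact norm_le_pi_norm θs u
    have h2 := le_max_left (σ * √(Real.log M)) ‖θs‖
    have h3 := le_max_right (σ * √(Real.log M)) ‖θs‖
    have h4 : σ * (6 * √(Real.log M)) ≤ σ * |ε u ω| := by linarith
    exact le_of_mul_le_mul_left h4 hσ
  have hexp : Real.exp (-(6 * √(Real.log M)) ^ 2 / 2) = 1 / M ^ 18 := by
    rw [mul_pow, Real.sq_sqrt hlog, show -(6 ^ 2 * Real.log M) / 2 = -((18 : ℕ) * Real.log M) by
      push_cast; ring, ← Real.log_pow, Real.exp_neg, Real.exp_log (by positivity), one_div]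
  calc _ ≤ ∑ u, μ.real {ω | 6 * √(Real.log M) ≤ |ε u ω|} :=
        (measureReal_mono hsub).trans (measureReal_iUnion_fintype_le _)
    _ ≤ ∑ _u : K, 4 * (1 / M ^ 18) := by
        refine Finset.sum_le_sum fun u _ => ?_
        rw [← hexp]
        exact measureReal_le_abs_noise_le hε u (by positivity)
    _ = 4 / M ^ 17 := by
        rw [Finset.sum_const, Finset.card_univ, nsmul_eq_mul, ← hM]
        field_simp

end Noise

/-! ### From regret to risk -/

section Risk

variable {K : Type} [DecidableEq K] [Fintype K] {N : ℕ} {Ω : Type*} [MeasurableSpace Ω]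
  {μ : Measure Ω} [IsProbabilityMeasure μ] {ε y : K → Ω → ℝ} {ρ : Ω → Fin N ≃ K}
  {r : OnlineRule K} {E : Finset (Finset K)} {θs : K → ℝ} {σ lam : ℝ}

theorem integrable_sq_aggregate_sub (hr : ∀ S U s, Measurable (r S U s)) (hlam : 0 ≤ lam)
    (hy : ∀ s, Measurable (y s)) (hρ : ∀ t s, MeasurableSet {ω | ρ ω t = s}) (s : K) :
    Integrable (fun ω => (aggregate r E lam (ρ ω) (fun u => y u ω) s - θs s) ^ 2) μ := by
  refine Integrable.of_bound
    (((measurable_aggregate_random hr hy hρ s).sub_const _).pow_const 2).aestronglyMeasurable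
    ((lam + |θs s|) ^ 2) (Filter.Eventually.of_forall fun ω => ?_)
  rw [Real.norm_eq_abs, abs_pow]
  refine pow_le_pow_left₀ (abs_nonneg _) ((abs_sub _ _).trans ?_) 2
  gcongr
  exact abs_aggregate_le hlam s

/-- A regret bound on the event that the data are bounded by the truncation level implies a bound
for the risk. -/
theorem integral_sum_sq_aggregate_sub_le (hr : ∀ S U s, Measurable (r S U s)) (hσ : 0 < σ)
    (hε : IsSubGaussianNoise μ ε) (hy : ∀ s ω, y s ω = θs s + σ * ε s ω)
    (hρ : IsNonAnticipating μ ε y ρ) (hlam : 0 < lam) (hK : 2 ≤ Fintype.card K)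
    (hC : 7 * max (σ * √(Real.log (Fintype.card K))) ‖θs‖ ≤ lam) (T : Finset K) (θ : K → ℝ)
    {B : ℝ} (hB : 0 ≤ B)
    (hreg : ∀ ω, (∀ u, |y u ω| ≤ lam) →
      ∑ s ∈ T, (y s ω - aggregate r E lam (ρ ω) (fun u => y u ω) s) ^ 2
        - ∑ s ∈ T, (y s ω - θ s) ^ 2 ≤ B) :
    ∫ ω, ∑ s ∈ T, (aggregate r E lam (ρ ω) (fun u => y u ω) s - θs s) ^ 2 ∂μ
      ≤ ∑ s ∈ T, (θs s - θ s) ^ 2 + B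
        + T.card * ((σ ^ 2 + lam ^ 2) / (Fintype.card K : ℝ) ^ 2) := by
  have hym (s : K) : Measurable (y s) := by
    rw [show y s = fun ω => θs s + σ * ε s ω from funext (hy s)]
    exact ((hε.measurable s).const_mul σ).const_add _
  set f : K → Ω → ℝ := fun s ω => aggregate r E lam (ρ ω) (fun u => y u ω) s with hf
  have hfm (s : K) : Measurable (f s) := measurable_aggregate_random hr hym hρ.measurable s
  have hfb (s : K) (ω : Ω) : |f s ω| ≤ lam := abs_aggregate_le hlam.le s
  have hfint (s : K) : Integrable (fun ω => (f s ω - θs s) ^ 2) μ :=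
    integrable_sq_aggregate_sub hr hlam.le hym hρ.measurable s
  have hεint := integrable_noise hε
  have hfε (s : K) : Integrable (fun ω => f s ω * ε s ω) μ :=
    (hεint s).bdd_mul (c := lam) (hfm s).aestronglyMeasurable
      (Filter.Eventually.of_forall fun ω => hfb s ω)
  have hfε0 (s : K) : ∫ ω, f s ω * ε s ω ∂μ = 0 :=
    integral_aggregate_mul_noise_eq_zero hr hlam.le hε.measurable hym hρ (hεint s) (hε.mean_zero s)
  set M : ℝ := ((Fintype.card K : ℕ) : ℝ) with hM
  have hM2 : 2 ≤ M := by rw [hM]; exact_mod_cast hK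
  have hM0 : 0 < M := by linarith
  set G : Set Ω := {ω | ∃ u, lam < |θs u + σ * ε u ω|} with hG
  have hGm : MeasurableSet G := by
    have : G = ⋃ u, {ω | lam < |y u ω|} := by
      ext ω
      simp [hG, hy]
    rw [this]
    exact MeasurableSet.iUnion fun u => measurableSet_lt measurable_const (hym u).abs
  have hGp : μ.real G ≤ 4 / M ^ 17 :=
    measureReal_exists_lt_abs_le hε hσ (by omega) hC
  have hθlam (s : K) : |θs s| ≤ lam := by
    have h1 := norm_le_pi_norm θs s
    have h2 := le_max_right (σ * √(Real.log M)) ‖θs‖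
    have h3 := norm_nonneg θs
    rw [Real.norm_eq_abs] at h1
    linarith
  have hdecomp (ω : Ω) : ∑ s ∈ T, (f s ω - θs s) ^ 2
      = ∑ s ∈ T, (θs s - θ s) ^ 2
        + (∑ s ∈ T, (y s ω - f s ω) ^ 2 - ∑ s ∈ T, (y s ω - θ s) ^ 2)
        + ∑ s ∈ T, (2 * σ * (f s ω * ε s ω) - 2 * σ * θ s * ε s ω) := by
    rw [← Finset.sum_sub_distrib, ← Finset.sum_add_distrib, ← Finset.sum_add_distrib]
    refine Finset.sum_congr rfl fun s _ => ?_
    rw [hy]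
    ring
  -- Off the bad event G this is the regret bound; on G the loss of the comparator is dropped and
  -- that of the predictor bounded crudely.
  have hbad (ω : Ω) : ∑ s ∈ T, (y s ω - f s ω) ^ 2 - ∑ s ∈ T, (y s ω - θ s) ^ 2
      ≤ B + ∑ s ∈ T, (G.indicator (fun _ => 6 * lam ^ 2 + 144 * σ ^ 2 * M ^ 2) ω
          + σ ^ 2 / (64 * M ^ 2) * ε s ω ^ 4) := by
    by_cases hω : ω ∈ G
    · have h1 : ∑ s ∈ T, (y s ω - f s ω) ^ 2
          ≤ ∑ s ∈ T, (G.indicator (fun _ => 6 * lam ^ 2 + 144 * σ ^ 2 * M ^ 2) ω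
          + σ ^ 2 / (64 * M ^ 2) * ε s ω ^ 4) := by
        refine Finset.sum_le_sum fun s _ => ?_
        rw [Set.indicator_of_mem hω, hy]
        have e1 : (θs s + σ * ε s ω - f s ω) ^ 2
            ≤ 3 * θs s ^ 2 + 3 * f s ω ^ 2 + 3 * σ ^ 2 * ε s ω ^ 2 := by
          nlinarith [sq_nonneg (θs s + f s ω), sq_nonneg (θs s - σ * ε s ω),
            sq_nonneg (f s ω + σ * ε s ω)]
        have e2 : θs s ^ 2 ≤ lam ^ 2 := sq_le_sq' (abs_le.1 (hθlam s)).1 (abs_le.1 (hθlam s)).2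
        have e3 : f s ω ^ 2 ≤ lam ^ 2 := sq_le_sq' (abs_le.1 (hfb s ω)).1 (abs_le.1 (hfb s ω)).2
        -- A perfect square, weighted so that the fourth moment 32 contributes only σ²/(2M²), while
        -- the M² term is multiplied by the tiny probability of G.
        have e4 : 3 * σ ^ 2 * ε s ω ^ 2
            ≤ 144 * σ ^ 2 * M ^ 2 + σ ^ 2 / (64 * M ^ 2) * ε s ω ^ 4 := by
          have : 144 * σ ^ 2 * M ^ 2 + σ ^ 2 / (64 * M ^ 2) * ε s ω ^ 4 - 3 * σ ^ 2 * ε s ω ^ 2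
              = σ ^ 2 / (64 * M ^ 2) * (ε s ω ^ 2 - 96 * M ^ 2) ^ 2 := by
            field_simp
            ring
          have h2 : 0 ≤ σ ^ 2 / (64 * M ^ 2) * (ε s ω ^ 2 - 96 * M ^ 2) ^ 2 := by positivity
          linarith
        linarith
      have h2 : 0 ≤ ∑ s ∈ T, (y s ω - θ s) ^ 2 := Finset.sum_nonneg fun s _ => sq_nonneg _
      linarith
    · have h1 := hreg ω fun u => by
        rw [hy]
        by_contra h
        exact hω ⟨u, not_le.1 h⟩
      have h2 : 0 ≤ ∑ s ∈ T, (G.indicator (fun _ => 6 * lam ^ 2 + 144 * σ ^ 2 * M ^ 2) ω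
          + σ ^ 2 / (64 * M ^ 2) * ε s ω ^ 4) := by
        refine Finset.sum_nonneg fun s _ => ?_
        rw [Set.indicator_of_notMem hω]
        positivity
      linarith
  have hi1 (s : K) : Integrable (fun ω => G.indicator
      (fun _ => 6 * lam ^ 2 + 144 * σ ^ 2 * M ^ 2) ω + σ ^ 2 / (64 * M ^ 2) * ε s ω ^ 4) μ :=
    ((integrable_const _).indicator hGm).add ((integrable_noise_pow_four hε s).const_mul _)
  have hi2 (s : K) : Integrable (fun ω => 2 * σ * (f s ω * ε s ω) - 2 * σ * θ s * ε s ω) μ :=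
    ((hfε s).const_mul _).sub ((hεint s).const_mul _)
  have hv1 (s : K) : ∫ ω, (G.indicator (fun _ => 6 * lam ^ 2 + 144 * σ ^ 2 * M ^ 2) ω
      + σ ^ 2 / (64 * M ^ 2) * ε s ω ^ 4) ∂μ ≤ (σ ^ 2 + lam ^ 2) / M ^ 2 := by
    rw [integral_add ((integrable_const _).indicator hGm)
      ((integrable_noise_pow_four hε s).const_mul _), integral_indicator hGm, setIntegral_const,
      integral_const_mul, smul_eq_mul]
    have h1 : μ.real G * (6 * lam ^ 2 + 144 * σ ^ 2 * M ^ 2)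
        ≤ 4 / M ^ 17 * (6 * lam ^ 2 + 144 * σ ^ 2 * M ^ 2) := by gcongr
    have h2 : σ ^ 2 / (64 * M ^ 2) * ∫ ω, ε s ω ^ 4 ∂μ ≤ σ ^ 2 / (64 * M ^ 2) * 32 := by
      gcongr
      exact integral_noise_pow_four_le hε s
    -- 8192 = 2^13; this is where at least two lattice points are needed.
    have h13 : (8192 : ℝ) ≤ M ^ 13 := by
      have := pow_le_pow_left₀ (by norm_num) hM2 13
      norm_num at this ⊢
      exact this
    have h15 : (8192 : ℝ) ≤ M ^ 15 := by
      have : M ^ 15 = M ^ 13 * M ^ 2 := by ring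
      rw [this]
      nlinarith
    have h3 : 4 / M ^ 17 * (6 * lam ^ 2 + 144 * σ ^ 2 * M ^ 2) + σ ^ 2 / (64 * M ^ 2) * 32
        = (24 / M ^ 15 * lam ^ 2 + (576 / M ^ 13 + 1 / 2) * σ ^ 2) / M ^ 2 := by
      field_simp
      ring
    have h4 : 24 / M ^ 15 ≤ 1 := by
      rw [div_le_one (by positivity)]
      linarith
    have h5 : 576 / M ^ 13 + 1 / 2 ≤ 1 := by
      have : 576 / M ^ 13 ≤ 1 / 2 := by
        rw [div_le_iff₀ (by positivity)]
        linarith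
      linarith
    have h6 : (24 / M ^ 15 * lam ^ 2 + (576 / M ^ 13 + 1 / 2) * σ ^ 2) / M ^ 2
        ≤ (σ ^ 2 + lam ^ 2) / M ^ 2 := by
      refine div_le_div_of_nonneg_right ?_ (by positivity)
      nlinarith [sq_nonneg lam, sq_nonneg σ]
    linarith
  have hv2 (s : K) : ∫ ω, (2 * σ * (f s ω * ε s ω) - 2 * σ * θ s * ε s ω) ∂μ = 0 := by
    rw [integral_sub ((hfε s).const_mul _) ((hεint s).const_mul _), integral_const_mul,
      integral_const_mul, hfε0, hε.mean_zero]
    simp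
  have hS1 : Integrable (fun ω => ∑ s ∈ T, (G.indicator
      (fun _ => 6 * lam ^ 2 + 144 * σ ^ 2 * M ^ 2) ω + σ ^ 2 / (64 * M ^ 2) * ε s ω ^ 4)) μ :=
    integrable_finsetSum _ fun s _ => hi1 s
  have hS2 : Integrable (fun ω =>
      ∑ s ∈ T, (2 * σ * (f s ω * ε s ω) - 2 * σ * θ s * ε s ω)) μ :=
    integrable_finsetSum _ fun s _ => hi2 s
  have hS12 : Integrable (fun ω => ∑ s ∈ T, (G.indicator
      (fun _ => 6 * lam ^ 2 + 144 * σ ^ 2 * M ^ 2) ω + σ ^ 2 / (64 * M ^ 2) * ε s ω ^ 4)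
      + ∑ s ∈ T, (2 * σ * (f s ω * ε s ω) - 2 * σ * θ s * ε s ω)) μ := hS1.add hS2
  refine (integral_mono (integrable_finsetSum _ fun s _ => hfint s)
    ((integrable_const (∑ s ∈ T, (θs s - θ s) ^ 2 + B)).add hS12) fun ω => ?_).trans ?_
  · have h1 := hdecomp ω
    have h2 := hbad ω
    simp only [Pi.add_apply]
    linarith
  simp only [Pi.add_apply]
  rw [integral_add (integrable_const _) hS12, integral_add hS1 hS2,
    integral_finsetSum _ fun s _ => hi1 s, integral_finsetSum _ fun s _ => hi2 s,
    Finset.sum_congr rfl fun s _ => hv2 s, Finset.sum_const_zero, add_zero, integral_const]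
  have := Finset.sum_le_card_nsmul T _ _ fun s _ => hv1 s
  rw [nsmul_eq_mul] at this
  simp only [probReal_univ, one_smul]
  linarith

end Risk

/-! ### The one-point lattice -/

section OLRADRE

variable {d n m : ℕ} {Ω : Type*} [MeasurableSpace Ω] {μ : Measure Ω} [IsProbabilityMeasure μ]
  {θs : Grid d n → ℝ} {σ lam : ℝ} {ε y : Grid d n → Ω → ℝ} {ρ : Ω → Fin (n ^ d) ≃ Grid d n}

/-- The risk bound on a lattice with a single point. -/
theorem integral_sq_olradre_sub_le_of_subsingleton (hd : 1 ≤ d) (hn : n = 1) (hlam : 0 < lam)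
    (hθ : ‖θs‖ ≤ lam) {T : Finset (Grid d n)} (hT : T.Nonempty) (P : Finpartition T) {s : ℝ}
    (hs : 0 ≤ s) :
    ∫ ω, (1 / (T.card : ℝ)) *
        ∑ u ∈ T, (olradre d n m lam (ρ ω) (fun u => y u ω) u - θs u) ^ 2 ∂μ
      ≤ regretConst m d * (lam + s) ^ 2 * ((P.parts.card : ℝ) / T.card)
          * Real.log (Real.exp 1 * n) ^ d * Real.log ((2 : ℝ) ^ d * (n : ℝ) ^ d) := by
  have hT0 : (0 : ℝ) < T.card := by exact_mod_cast hT.card_pos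
  have hT1 : (T.card : ℝ) = 1 := by
    have : T.card ≤ 1 := by
      have := Finset.card_le_univ T
      simpa [hn] using this
    have h2 := hT.card_pos
    exact_mod_cast (by omega : T.card = 1)
  have hP : (1 : ℝ) ≤ P.parts.card := by
    exact_mod_cast Finset.card_pos.2 (P.parts_nonempty hT.ne_empty)
  have hL := one_half_le_log_two_pow_mul hd (n := n) (by omega)
  have hpt (ω : Ω) : (1 / (T.card : ℝ)) *
      ∑ u ∈ T, (olradre d n m lam (ρ ω) (fun u => y u ω) u - θs u) ^ 2 ≤ 4 * lam ^ 2 := by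
    rw [one_div, inv_mul_le_iff₀ hT0, ← nsmul_eq_mul]
    refine Finset.sum_le_card_nsmul _ _ _ fun u _ => ?_
    have h1 := abs_le.1 (abs_aggregate_le (r := vawRule (feature d n m))
      (E := dyadicRectangles d n) (ρ := ρ ω) (y := fun u => y u ω) hlam.le u)
    have h2 := abs_le.1 ((norm_le_pi_norm θs u).trans hθ)
    rw [olradre]
    nlinarith
  have hle : ∫ ω, (1 / (T.card : ℝ)) *
      ∑ u ∈ T, (olradre d n m lam (ρ ω) (fun u => y u ω) u - θs u) ^ 2 ∂μ ≤ 4 * lam ^ 2 := by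
    have := integral_mono_of_nonneg (μ := μ)
      (Filter.Eventually.of_forall fun ω => mul_nonneg (by positivity)
        (Finset.sum_nonneg fun u _ => sq_nonneg _)) (integrable_const (4 * lam ^ 2))
      (Filter.Eventually.of_forall hpt)
    simpa using this
  refine hle.trans ?_
  have hsq : lam ^ 2 ≤ (lam + s) ^ 2 := pow_le_pow_left₀ hlam.le (by linarith) 2
  have hn' : (n : ℝ) = 1 := by rw [hn, Nat.cast_one]
  rw [hn', mul_one, Real.log_exp, one_pow (M := ℝ) d, mul_one, mul_one, hT1, div_one]
  rw [hn', one_pow, mul_one] at hL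
  -- The trivial error (2λ)² is absorbed because the constant is at least 16 and the logarithm at
  -- least 1/2.
  calc 4 * lam ^ 2 ≤ 16 * (lam + s) ^ 2 * 1 * (1 / 2) := by nlinarith [sq_nonneg lam]
    _ ≤ _ := by
      have := sixteen_le_regretConst m d
      gcongr

end OLRADRE

end OnlineAgg

/-! ### Assembly of the risk bound -/

theorem theorem5p1 :
    ∃ C : ℝ, 0 < C ∧ ∀ m d : ℕ, 1 ≤ d → ∃ Cmd : ℝ, 1 < Cmd ∧
      ∀ (k n : ℕ), n = 2 ^ k →
      ∀ (Ω : Type*) [MeasurableSpace Ω] (μ : Measure Ω) [IsProbabilityMeasure μ]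
        (θs : Grid d n → ℝ) (σ : ℝ) (ε : Grid d n → Ω → ℝ) (y : Grid d n → Ω → ℝ)
        (ρ : Ω → Fin (n ^ d) ≃ Grid d n) (lam : ℝ),
        0 < σ → IsSubGaussianNoise μ ε → (∀ s ω, y s ω = θs s + σ * ε s ω) →
        IsNonAnticipating μ ε y ρ →
        0 < lam → C * max (σ * √(Real.log ((n : ℝ) ^ d))) ‖θs‖ ≤ lam →
        ∀ T : Finset (Grid d n), T.Nonempty →
          Integrable (fun ω => (1 / (T.card : ℝ)) *
            ∑ s ∈ T, (olradre d n m lam (ρ ω) (fun u => y u ω) s - θs s) ^ 2) μ ∧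
          ∀ P : Finpartition T, (∀ R ∈ P.parts, IsRectangle R) →
          ∀ (θ : Grid d n → ℝ) (β : Finset (Grid d n) → MultiDeg d m → ℝ),
            IsPiecewisePoly P.parts β θ →
            ∫ ω, (1 / (T.card : ℝ)) *
                ∑ s ∈ T, (olradre d n m lam (ρ ω) (fun u => y u ω) s - θs s) ^ 2 ∂μ
              ≤ (1 / (T.card : ℝ)) * ∑ s ∈ T, (θs s - θ s) ^ 2
                + Cmd * (lam + coeffNorm P.parts β) ^ 2 * ((P.parts.card : ℝ) / T.card)
                    * Real.log (Real.exp 1 * n) ^ d * Real.log ((2 : ℝ) ^ d * (n : ℝ) ^ d)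
                + (σ ^ 2 + lam ^ 2) / (T.card : ℝ) ^ 2 := by
  refine ⟨7, by norm_num, fun m d hd => ⟨regretConst m d, one_lt_regretConst m d, ?_⟩⟩
  intro k n hk Ω _ μ _ θs σ ε y ρ lam hσ hε hy hρ hlam hC T hT
  have hr : ∀ S U s, Measurable (vawRule (feature d n m) S U s) := measurable_vawRule _
  have hym (s : Grid d n) : Measurable (y s) := by
    rw [show y s = fun ω => θs s + σ * ε s ω from funext (hy s)]
    exact ((hε.measurable s).const_mul σ).const_add _
  refine ⟨(integrable_finsetSum _ fun s _ =>
    integrable_sq_aggregate_sub hr hlam.le hym hρ.measurable s).const_mul _,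
    fun P hP θ β hθ => ?_⟩
  have hT0 : (0 : ℝ) < T.card := by exact_mod_cast hT.card_pos
  have hn0 : n ≠ 0 := by rw [hk]; positivity
  have hcard : Fintype.card (Grid d n) = n ^ d := by simp
  have hL := one_half_le_log_two_pow_mul hd hn0
  -- For n = 1 the logarithm of the number of points vanishes and λ need not dominate the noise, so
  -- the boundedness of the predictor is used instead.
  rcases (show n = 1 ∨ 2 ≤ n by omega) with hn | hn
  · have hθlam : ‖θs‖ ≤ lam := by
      have h1 := le_max_right (σ * √(Real.log ((n : ℝ) ^ d))) ‖θs‖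
      linarith [norm_nonneg θs]
    have h1 := integral_sq_olradre_sub_le_of_subsingleton (m := m) (μ := μ) (y := y) (ρ := ρ) hd hn
      hlam hθlam hT P (coeffNorm P.parts β).coe_nonneg
    have h2 : 0 ≤ (1 / (T.card : ℝ)) * ∑ s ∈ T, (θs s - θ s) ^ 2 :=
      mul_nonneg (by positivity) (Finset.sum_nonneg fun s _ => sq_nonneg _)
    have h3 : 0 ≤ (σ ^ 2 + lam ^ 2) / (T.card : ℝ) ^ 2 := by positivity
    linarith
  · have hK : 2 ≤ Fintype.card (Grid d n) := by
      rw [hcard]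
      exact hn.trans (Nat.le_self_pow (by omega) n)
    have hB : 0 ≤ regretConst m d * (lam + coeffNorm P.parts β) ^ 2 * P.parts.card
        * Real.log (Real.exp 1 * n) ^ d * Real.log ((2 : ℝ) ^ d * (n : ℝ) ^ d) := by
      have h1 := one_lt_regretConst m d
      have h2 : 0 ≤ Real.log (Real.exp 1 * n) := by
        have := two_mul_add_one_le_log hk
        have := Nat.cast_nonneg (α := ℝ) k
        linarith
      have h3 : 0 ≤ Real.log ((2 : ℝ) ^ d * (n : ℝ) ^ d) := by linarith
      positivity
    have hrisk := integral_sum_sq_aggregate_sub_le (E := dyadicRectangles d n) hr hσ hε hy hρ hlam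
      hK (by rw [hcard]; exact_mod_cast hC) T θ hB fun ω hω =>
        sum_sq_sub_olradre_sub_le hd hk hlam (ρ ω) hω P hP hθ
    -- The bad event costs (σ² + λ²)/N² per point, and |T| ≤ N.
    have hlast : (σ ^ 2 + lam ^ 2) / (Fintype.card (Grid d n) : ℝ) ^ 2
        ≤ (σ ^ 2 + lam ^ 2) / (T.card : ℝ) ^ 2 := by
      gcongr
      exact Finset.card_le_univ T
    rw [integral_const_mul, one_div, inv_mul_le_iff₀ hT0]
    refine hrisk.trans (le_trans (add_le_add_right
      (mul_le_mul_of_nonneg_left hlast hT0.le) _) (le_of_eq ?_))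
    field_simp
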